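/- **Notation.** For $c\in\mathbb R$ let $c^\ddagger=1/c$ if $c\ne0$ and $0^\ddagger=1$; for vectors, $\mathrm{diag}^\ddagger(\xi)=\mathrm{diag}(\xi_1^\ddagger,\xi_2^\ddagger,\dots)$ and $a/\xi=\mathrm{diag}^\ddagger(\xi)a$ (entry-wise division; the same convention $0^\ddagger=1$ is used for division by the scalar $\|L^Tx\|_\infty$ below). Let $\mathrm{vec}(A,b)$ be the columns of $A$ stacked, followed by $b$; let $\Pi_{mn}$ be the permutation matrix with $\Pi_{mn}\mathrm{vec}(A)=\mathrm{vec}(A^T)$ for $A\in\mathbb R^{m\times n}$; $|\cdot|$ of a matrix or vector is taken entry-wise; $\|\cdot\|_{\mu,\nu}$ is the matrix norm induced by vector norms $\|\cdot\|_\mu$ (domain) and $\|\cdot\|_\nu$ (range). **Condition numbers.** For a map $F$ on an open set $\mathrm{Dom}(F)\subseteq\mathbb R^{N}$, differentiable at $z\in\mathrm{Dom}(F)$, a set $\mathcal S$ of allowed perturbations, and parameters $\beta$ (in the data space) and $\xi$ (in the range), the condition number of $F$ at $z$ is $$\lim_{\delta\to0}\ \sup_{0<\|\Delta/\beta\|_\mu\le\delta}\frac{\left\|\frac{F(z+\Delta)-F(z)}{\xi}\right\|_\nu}{\|\Delta/\beta\|_\mu}\quad\text{or,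 through the Fr\'echet derivative,}\quad \sup_{\|\Delta/\beta\|_\mu\ne0}\frac{\left\|\frac{F'(z)\Delta}{\xi}\right\|_\nu}{\|\Delta/\beta\|_\mu},$$ where $\Delta$ ranges over the elements of $\mathcal S$ (with $z+\Delta\in \mathrm{Dom}(F)$ in the first expression) such that $\Delta_i=0$ whenever $\beta_i=0$, and a supremum over the empty set is $0$. Without further mention $\mathcal S$ is the whole space. A positive real number used as a parameter stands for the constant vector. In what follows, "the condition number equals $c$" means that $F$ is differentiable at $z$, the limit exists, and both expressions equal $c$. **Setting.** Let $A\in\mathbb R^{m\times n}$, $b\in\mathbb R^m$, $m\ge n\ge1$, $L\in\mathbb R^{n\times k}$. Let $\sigma_n$ be the smallest singular value of $A$ and $\widetilde\sigma_{n+1}$ the $(n+1)$-st singular value of $[A,b]$ (the square root of the smallest eigenvalue of $[A,b]^T[A,b]$). Assume $\widetilde\sigma_{n+1}<\sigma_n$. Put $$\widetilde A=\begin{bmatrix}A\\ \widetilde\sigma_{n+1}I_n\end{bmatrix},\quad \widetilde b=\begin{bmatrix}b\\0\end{bmatrix},\quad \widetilde J=\begin{bmatrix}I_m&0\\0&-I_n\end{bmatrix},\quad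 \widetilde M=\widetilde A^T\widetilde J\widetilde A,\quad x=x(A,b)=\widetilde M^{-1}\widetilde A^T\widetilde J\widetilde b,\quad r=b-Ax,$$ $$D_\sigma=L^T\widetilde M^{-1}\Big(A^T+\frac{2xr^T}{1+\|x\|_2^2}\Big),\qquad N=\big(r^T\otimes(L^T\widetilde M^{-1})\big)\Pi_{mn}-x^T\otimes D_\sigma .$$ **Theorem.** (1) $\widetilde M=A^TA-\widetilde\sigma_{n+1}^2I_n$ is positive definite and $x=\widetilde M^{-1}A^Tb$. This $x$ is the unique solution of the indefinite least squares problem $\min_y(\widetilde b-\widetilde Ay)^T\widetilde J(\widetilde b-\widetilde Ay)$ (that is, the problem with $B=\widetilde\sigma_{n+1}I_n$, $d=0$), and it is also the unique solution of the total least squares (TLS) problem $\min_{E,\epsilon}\|[E,\epsilon]\|_F$ subject to $(A+E)x=b+\epsilon$. The set of all $(A,b)$ with $\widetilde\sigma_{n+1}<\sigma_n$ is open; on it consider the map $(A,b)\mapsto L^Tx(A,b)$, where $(A,b)$ is identified with $\mathrm{vec}(A,b)$. Its condition numbers at $(A,b)$ are as follows. (2) (Partial unified condition number.) Let $\|\cdot\|_\mu$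 be a norm on $\mathbb R^{mn+m}$, $\|\cdot\|_\nu$ a norm on $\mathbb R^k$, and $\Psi\in\mathbb R^{m\times n}$, $\beta\in\mathbb R^m$, $\xi\in\mathbb R^k$. If $(\Psi,\beta)$ has zero entries, assume that replacing the coordinates of a vector at these positions by $0$ never increases $\|\cdot\|_\mu$ (true for every $p$-norm and every absolute norm). Then the condition number with parameters $(\Psi,\beta)$ and $\xi$ is $$\kappa_{TLS}(A,b)=\big\|\mathrm{diag}^\ddagger(\xi)\,[N,\ D_\sigma]\,\mathrm{diag}(\mathrm{vec}(\Psi,\beta))\big\|_{\mu,\nu}.$$ (3) (2-norm.) For $\mu=\nu=2$ and positive real numbers $\Psi,\beta,\xi$ it is $\kappa_{2TLS}(A,b)=\|[\Psi N,\ \beta D_\sigma]\|_2/\xi$. (4) (Mixed and componentwise.) For $\mu=\nu=\infty$, $\Psi=A$, $\beta=b$, and $\xi=[\|L^Tx\|_\infty,\dots,\|L^Tx\|_\infty]^T$, respectively $\xi=L^Tx$, it is $$\kappa_{mTLS}(A,b)=\frac{\big\|\,|[N,D_\sigma]|\,|\mathrm{vec}(A,b)|\,\big\|_\infty}{\|L^Tx\|_\infty},\qquad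 \kappa_{cTLS}(A,b)=\left\|\frac{|[N,D_\sigma]|\,|\mathrm{vec}(A,b)|}{|L^Tx|}\right\|_\infty .$$ (5) (Structured.) Let $\mathbb S_1\subseteq\mathbb R^{m\times n}$, $\mathbb S_2\subseteq\mathbb R^m$ be linear subspaces with structure matrices $\Phi_1,\Phi_2$, that is, $\mathrm{vec}(\mathbb S_1)$ is the range of $\Phi_1$, $\mathbb S_2$ is the range of $\Phi_2$, and the columns of each $\Phi_i$ are nonzero and pairwise orthogonal. Let $D_i$ be the diagonal matrix of the Euclidean norms of the columns of $\Phi_i$, and allow only the perturbations $\Delta A\in\mathbb S_1$, $\Delta b\in\mathbb S_2$. For $\mu=\nu=2$ and positive real numbers $\Psi,\beta,\xi$ the structured condition number is $$\kappa^S_{2TLS}(A,b)=\frac{\big\|[\Psi N\Phi_1D_1^{-1},\ \beta D_\sigma\Phi_2D_2^{-1}]\big\|_2}{\xi}.$$ If, moreover, each row of $\Phi_1$ and of $\Phi_2$ has at most one nonzero entry, and $\mathrm{vec}(A)=\Phi_1s_1$, $b=\Phi_2s_2$, then for $\mu=\nu=\infty$, $\Psi=A$, $\beta=b$, and $\xi=[\|L^Tx\|_\infty,\dots,\|L^Tx\|_\infty]^T$,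 respectively $\xi=L^Tx$, it is $$\kappa^S_{mTLS}(A,b)=\frac{\Big\|\,|[N\Phi_1,\ D_\sigma\Phi_2]|\,\Big|\begin{bmatrix}s_1\\s_2\end{bmatrix}\Big|\,\Big\|_\infty}{\|L^Tx\|_\infty},\qquad \kappa^S_{cTLS}(A,b)=\left\|\frac{|[N\Phi_1,\ D_\sigma\Phi_2]|\,\Big|\begin{bmatrix}s_1\\s_2\end{bmatrix}\Big|}{|L^Tx|}\right\|_\infty .$$ -/

import Mathlib

open Matrix Filter Topology
open scoped Kronecker ENNReal

noncomputable section

/-! ### Entry-wise division, norms, condition numbers -/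

/-- `c^‡ = 1 / c` for `c ≠ 0`, and `0^‡ = 1`. -/
def ddag (c : ℝ) : ℝ := if c = 0 then 1 else 1 / c

/-- The entry-wise division `a / b = diag^‡(b) a` of vectors. -/
def entryDiv {ι : Type*} (a b : ι → ℝ) : ι → ℝ := fun i => ddag (b i) * a i

/-- `diag^‡(b)`. -/
def diagDdag {ι : Type*} [DecidableEq ι] (b : ι → ℝ) : Matrix ι ι ℝ :=
  Matrix.diagonal fun i => ddag (b i)

/-- A norm on `ℝ^ι`: a seminorm that vanishes only at `0`. -/
def IsVecNorm {ι : Type*} (μ : Seminorm ℝ (ι → ℝ)) : Prop := ∀ y, μ y = 0 → y = 0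

/-- The Euclidean norm on `ℝ^ι`. -/
def norm2 (ι : Type*) [Fintype ι] : Seminorm ℝ (ι → ℝ) :=
  (normSeminorm ℝ (EuclideanSpace ℝ ι)).comp (WithLp.linearEquiv 2 ℝ (ι → ℝ)).symm.toLinearMap

/-- The maximum norm on `ℝ^ι`. -/
def normInf (ι : Type*) [Fintype ι] : Seminorm ℝ (ι → ℝ) := normSeminorm ℝ (ι → ℝ)

/-- The matrix norm `‖N‖_{μ,ν}` induced by the vector norms `‖·‖_μ` (on the domain) and `‖·‖_ν`. -/
def inducedNorm {ι κ : Type*} [Fintype ι] (μ : Seminorm ℝ (ι → ℝ)) (ν : Seminorm ℝ (κ → ℝ))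
    (N : Matrix κ ι ℝ) : ℝ :=
  sSup {t : ℝ | ∃ y : ι → ℝ, y ≠ 0 ∧ t = ν (N *ᵥ y) / μ y}

/-- The spectral norm of a matrix. -/
def spectralNorm2 {ι κ : Type*} [Fintype ι] [Fintype κ] (N : Matrix κ ι ℝ) : ℝ :=
  inducedNorm (norm2 ι) (norm2 κ) N

/-- The perturbations which lie in the class `S` and respect the requirement that an entry is not
perturbed when the corresponding entry of the parameter `β` is zero. -/
def admissible {ι : Type*} (S : Set (ι → ℝ)) (β : ι → ℝ) : Set (ι → ℝ) :=
  {Δ | Δ ∈ S ∧ ∀ i, β i = 0 → Δ i = 0}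

/-- The supremum of `‖(F(z+Δ) - F(z))/ξ‖_ν / ‖Δ/β‖_μ` over `0 < ‖Δ/β‖_μ ≤ δ`. -/
def condSup {ι κ : Type*} (F : (ι → ℝ) → (κ → ℝ)) (dom S : Set (ι → ℝ))
    (μ : Seminorm ℝ (ι → ℝ)) (ν : Seminorm ℝ (κ → ℝ)) (β : ι → ℝ) (ξ : κ → ℝ)
    (z : ι → ℝ) (δ : ℝ) : ℝ≥0∞ :=
  ⨆ Δ ∈ {Δ | Δ ∈ admissible S β ∧ z + Δ ∈ dom ∧
      0 < μ (entryDiv Δ β) ∧ μ (entryDiv Δ β) ≤ δ},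
    ENNReal.ofReal (ν (entryDiv (F (z + Δ) - F z) ξ) / μ (entryDiv Δ β))

/-- The supremum of `‖(F'(z) ∘ Δ)/ξ‖_ν / ‖Δ/β‖_μ` over `‖Δ/β‖_μ ≠ 0`. -/
def condDerivSup {ι κ : Type*} [Fintype ι] [Fintype κ] (F : (ι → ℝ) → (κ → ℝ)) (S : Set (ι → ℝ))
    (μ : Seminorm ℝ (ι → ℝ)) (ν : Seminorm ℝ (κ → ℝ)) (β : ι → ℝ) (ξ : κ → ℝ)
    (z : ι → ℝ) : ℝ≥0∞ :=
  ⨆ Δ ∈ {Δ | Δ ∈ admissible S β ∧ μ (entryDiv Δ β) ≠ 0},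
    ENNReal.ofReal (ν (entryDiv (fderiv ℝ F z Δ) ξ) / μ (entryDiv Δ β))

/-- `c` is the condition number at `z` of the map `F` with domain `dom`, for perturbations from `S`:
the limit definition and the definition through the Fréchet derivative both apply and both give
the value `c`. The unstructured condition number is the case `S = univ`. -/
structure IsCondNumber {ι κ : Type*} [Fintype ι] [Fintype κ] (F : (ι → ℝ) → (κ → ℝ))
    (dom S : Set (ι → ℝ)) (μ : Seminorm ℝ (ι → ℝ)) (ν : Seminorm ℝ (κ → ℝ))
    (β : ι → ℝ) (ξ : κ → ℝ) (z : ι → ℝ) (c : ℝ) : Prop where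
  mem_dom : z ∈ dom
  differentiableAt : DifferentiableAt ℝ F z
  tendsto : Tendsto (condSup F dom S μ ν β ξ z) (𝓝[>] 0) (𝓝 (ENNReal.ofReal c))
  deriv_eq : condDerivSup F S μ ν β ξ z = ENNReal.ofReal c

/-! ### The data space `ℝ^{m×n} × ℝ^m`, flattened to `ℝ^{mn+m}` -/

/-- The index set of `vec(A, b)`. -/
abbrev DataIdx (m n : ℕ) : Type := (Fin n × Fin m) ⊕ Fin m

/-- `vec(A, b)`: the columns of `A`, followed by `b`. -/
def dataVec {m n : ℕ} (A : Matrix (Fin m) (Fin n) ℝ) (b : Fin m → ℝ) : DataIdx m n → ℝ :=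
  Sum.elim (Matrix.vec A) b

/-- The matrix part of a data vector. -/
def dataMat {m n : ℕ} (z : DataIdx m n → ℝ) : Matrix (Fin m) (Fin n) ℝ :=
  Matrix.of fun i j => z (Sum.inl (j, i))

/-- The right-hand side part of a data vector. -/
def dataRhs {m n : ℕ} (z : DataIdx m n → ℝ) : Fin m → ℝ := fun i => z (Sum.inr i)

/-- The vec-permutation matrix `Π_{mn}`, with `Π_{mn} vec(A) = vec(Aᵀ)` for `A : m × n`. -/
def vecPermMatrix (m n : ℕ) : Matrix (Fin m × Fin n) (Fin n × Fin m) ℝ :=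
  Matrix.of fun p q => if p = q.swap then 1 else 0

theorem vecPermMatrix_mulVec_vec {m n : ℕ} (A : Matrix (Fin m) (Fin n) ℝ) :
    vecPermMatrix m n *ᵥ Matrix.vec A = Matrix.vec Aᵀ := by
  ext ⟨i, j⟩
  have h : ∀ q : Fin n × Fin m, ((i, j) = q.swap) ↔ ((j, i) = q) := by
    rintro ⟨a, c⟩; simp [Prod.ext_iff, and_comm]
  simp [vecPermMatrix, Matrix.mulVec, dotProduct, Matrix.vec, h]

/-- The matrix `vᵀ ⊗ C` for a column vector `v`, whose rows are indexed like those of `C`. -/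
def rowKron {ι κ p : Type*} (v : ι → ℝ) (C : Matrix κ p ℝ) : Matrix κ (ι × p) ℝ :=
  (Matrix.replicateRow Unit v ⊗ₖ C).submatrix (fun i => ((), i)) id

/-! ### Indefinite least squares -/

/-- The objective `(b - Ax)ᵀ J (b - Ax)`. -/
def ilsObjective {ι κ : Type*} [Fintype ι] [Fintype κ] (J : Matrix ι ι ℝ) (A : Matrix ι κ ℝ)
    (b : ι → ℝ) (x : κ → ℝ) : ℝ :=
  (b - A *ᵥ x) ⬝ᵥ (J *ᵥ (b - A *ᵥ x))

/-- `x` is a solution of the indefinite least squares problem. -/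
def IsILSSolution {ι κ : Type*} [Fintype ι] [Fintype κ] (J : Matrix ι ι ℝ) (A : Matrix ι κ ℝ)
    (b : ι → ℝ) (x : κ → ℝ) : Prop :=
  ∀ y, ilsObjective J A b x ≤ ilsObjective J A b y

/-- `(Aᵀ J A)⁻¹ Aᵀ J b`. -/
def ilsSolution {ι κ : Type*} [Fintype ι] [Fintype κ] [DecidableEq κ] (J : Matrix ι ι ℝ)
    (A : Matrix ι κ ℝ) (b : ι → ℝ) : κ → ℝ :=
  (Aᵀ * J * A)⁻¹ *ᵥ (Aᵀ *ᵥ (J *ᵥ b))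

/-! ### Total least squares -/

/-- The augmented matrix `[A, b]`. -/
def augment {m n : ℕ} (A : Matrix (Fin m) (Fin n) ℝ) (b : Fin m → ℝ) :
    Matrix (Fin m) (Fin n ⊕ Unit) ℝ :=
  Matrix.fromCols A (Matrix.replicateCol Unit b)

/-- The Frobenius norm. -/
def frobNorm {ι κ : Type*} [Fintype ι] [Fintype κ] (C : Matrix ι κ ℝ) : ℝ :=
  Real.sqrt (∑ i, ∑ j, C i j ^ 2)

/-- `x` solves the total least squares problem: there is a perturbation `[E, ε]` of least Frobenius
norm among all those making the system consistent, and `(A + E) x = b + ε`. -/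
def IsTLSSolution {m n : ℕ} (A : Matrix (Fin m) (Fin n) ℝ) (b : Fin m → ℝ) (x : Fin n → ℝ) : Prop :=
  ∃ (E : Matrix (Fin m) (Fin n) ℝ) (ε : Fin m → ℝ), (A + E) *ᵥ x = b + ε ∧
    ∀ (E' : Matrix (Fin m) (Fin n) ℝ) (ε' : Fin m → ℝ) (x' : Fin n → ℝ),
      (A + E') *ᵥ x' = b + ε' → frobNorm (augment E ε) ≤ frobNorm (augment E' ε')

/-- `σ_n`, the smallest singular value of `A` (Mathlib numbers singular values from `0`). -/
def sigmaMin {m n : ℕ} (A : Matrix (Fin m) (Fin n) ℝ) : ℝ :=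
  (Matrix.toEuclideanLin A).singularValues (n - 1)

/-- `σ̃_{n+1}`, the smallest of the `n + 1` singular values of `[A, b]`. -/
def sigmaTilde {m n : ℕ} (A : Matrix (Fin m) (Fin n) ℝ) (b : Fin m → ℝ) : ℝ :=
  (Matrix.toEuclideanLin (augment A b)).singularValues n

/-- The data with `σ̃_{n+1} < σ_n`. -/
def tlsDomain (m n : ℕ) : Set (DataIdx m n → ℝ) :=
  {z | sigmaTilde (dataMat z) (dataRhs z) < sigmaMin (dataMat z)}

/-- `Ã`, that is, `A` stacked on `B = σ̃_{n+1} I_n`. -/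
def stackA {m n : ℕ} (A : Matrix (Fin m) (Fin n) ℝ) (b : Fin m → ℝ) :
    Matrix (Fin m ⊕ Fin n) (Fin n) ℝ :=
  Matrix.fromRows A (sigmaTilde A b • (1 : Matrix (Fin n) (Fin n) ℝ))

/-- `b̃`, that is, `b` stacked on `d = 0`. -/
def stackB {m : ℕ} (n : ℕ) (b : Fin m → ℝ) : Fin m ⊕ Fin n → ℝ := Sum.elim b 0

/-- `J̃ = diag(I_m, -I_n)`. -/
def stackJ (m n : ℕ) : Matrix (Fin m ⊕ Fin n) (Fin m ⊕ Fin n) ℝ :=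
  Matrix.fromBlocks 1 0 0 (-1)

/-- `M̃ = Ãᵀ J̃ Ã`. -/
def tlsM {m n : ℕ} (A : Matrix (Fin m) (Fin n) ℝ) (b : Fin m → ℝ) : Matrix (Fin n) (Fin n) ℝ :=
  (stackA A b)ᵀ * stackJ m n * stackA A b

/-- `x(A, b)`, the solution of the special indefinite least squares problem. -/
def tlsX {m n : ℕ} (A : Matrix (Fin m) (Fin n) ℝ) (b : Fin m → ℝ) : Fin n → ℝ :=
  ilsSolution (stackJ m n) (stackA A b) (stackB n b)

/-- The residual `r = b - A x(A, b)`. -/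
def tlsR {m n : ℕ} (A : Matrix (Fin m) (Fin n) ℝ) (b : Fin m → ℝ) : Fin m → ℝ :=
  b - A *ᵥ tlsX A b

/-- The map `(A, b) ↦ Lᵀ x(A, b)` on the flattened data space. -/
def tlsMap {m n k : ℕ} (L : Matrix (Fin n) (Fin k) ℝ) (z : DataIdx m n → ℝ) : Fin k → ℝ :=
  Lᵀ *ᵥ tlsX (dataMat z) (dataRhs z)

/-- `D_σ = Lᵀ M̃⁻¹ (Aᵀ + 2 x rᵀ / (1 + ‖x‖₂²))`. -/
def tlsD {m n k : ℕ} (A : Matrix (Fin m) (Fin n) ℝ) (b : Fin m → ℝ) (L : Matrix (Fin n) (Fin k) ℝ) :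
    Matrix (Fin k) (Fin m) ℝ :=
  Lᵀ * (tlsM A b)⁻¹ *
    (Aᵀ + (2 / (1 + tlsX A b ⬝ᵥ tlsX A b)) • Matrix.vecMulVec (tlsX A b) (tlsR A b))

/-- `(rᵀ ⊗ (Lᵀ M̃⁻¹)) Π_{mn} - xᵀ ⊗ D_σ`. -/
def tlsN {m n k : ℕ} (A : Matrix (Fin m) (Fin n) ℝ) (b : Fin m → ℝ) (L : Matrix (Fin n) (Fin k) ℝ) :
    Matrix (Fin k) (Fin n × Fin m) ℝ :=
  rowKron (tlsR A b) (Lᵀ * (tlsM A b)⁻¹) * vecPermMatrix m n - rowKron (tlsX A b) (tlsD A b L)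

/-- `[(rᵀ ⊗ (Lᵀ M̃⁻¹)) Π_{mn} - xᵀ ⊗ D_σ, D_σ]`. -/
def tlsMatrix {m n k : ℕ} (A : Matrix (Fin m) (Fin n) ℝ) (b : Fin m → ℝ)
    (L : Matrix (Fin n) (Fin k) ℝ) : Matrix (Fin k) (DataIdx m n) ℝ :=
  Matrix.fromCols (tlsN A b L) (tlsD A b L)

/-! ### Linear structures -/

/-- The data vectors `vec(C, c)` with `C ∈ S₁` and `c ∈ S₂`. -/
def structuredSet {m n : ℕ} (S₁ : Submodule ℝ (Matrix (Fin m) (Fin n) ℝ))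
    (S₂ : Submodule ℝ (Fin m → ℝ)) : Set (DataIdx m n → ℝ) :=
  {z | dataMat z ∈ S₁ ∧ dataRhs z ∈ S₂}

/-- The columns of `Φ` are nonzero and pairwise orthogonal. -/
def ColumnOrthogonal {ι κ : Type*} [Fintype ι] (Φ : Matrix ι κ ℝ) : Prop :=
  (∀ l, Φ.col l ≠ 0) ∧ ∀ l l', l ≠ l' → Φ.col l ⬝ᵥ Φ.col l' = 0

/-- Every row of `Φ` has at most one nonzero entry: every entry of a structured object depends on
at most one of the independent parameters. -/
def RowsAtMostOne {ι κ : Type*} (Φ : Matrix ι κ ℝ) : Prop :=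
  ∀ i l l', Φ i l ≠ 0 → Φ i l' ≠ 0 → l = l'

/-- The diagonal matrix of the Euclidean norms of the columns of `Φ`. -/
def colNormDiag {ι κ : Type*} [Fintype ι] [DecidableEq κ] (Φ : Matrix ι κ ℝ) : Matrix κ κ ℝ :=
  Matrix.diagonal fun l => norm2 ι (Φ.col l)

/-- The entry-wise absolute value of a matrix. -/
def absMat {ι κ : Type*} (N : Matrix ι κ ℝ) : Matrix ι κ ℝ := N.map fun t => |t|

/-- The entry-wise absolute value of a vector. -/
def absVec {ι : Type*} (v : ι → ℝ) : ι → ℝ := fun i => |v i|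

end

/-! For a perturbation class closed under scaling and a differentiable map, both expressions for the
condition number equal the least `c ≥ 0` such that the scaled derivative is bounded by `c` times the
scaled perturbation (`isCondNumber_of_isLeast`). What remains is to differentiate `x(A, b)` and to
compute some least constants of linear maps.

Write `s = σ̃²`. Positive definiteness of `M̃ = AᵀA - s I` forces the last coordinate of an
eigenvector of `[A, b]ᵀ[A, b]` for `s` to be nonzero, so it can be normalised to `(x, -1)`. Its two
block rows read `Aᵀr = -s x` and `bᵀr = s`. Hence the indefinite objective at `y` is `s + (y -
x)ᵀM̃(y - x)`, and a consistent perturbation obeys `‖b - Ay‖² ≤ ‖[E, ε]‖_F² (1 + ‖y‖²)`. Together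
these settle both minimisation problems; a rank-one perturbation attains the bound.

The two rows combine into `(b - Ay)ᵀr = s (yᵀx + 1)` for every `y`. Applied crosswise at two data
points, this expresses the increment of `s` exactly, as data increments times continuous
coefficients. So continuity of `x` gives differentiability of `s`, and then of `x`, without
perturbation theory for eigenvalues. Differentiating the same identities yields `M̃ dx = dAᵀr + (Aᵀ
+ 2xrᵀ/(1 + ‖x‖²))(db - dA x)`, which is `[N, D_σ]` before `Lᵀ M̃⁻¹` is applied.

The least constants are an induced norm in general and a largest absolute row sum for the maximum
norm. Structured perturbations are pulled back to their parameters: isometrically after dividing by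
column norms for the 2-norm, and entry by entry for the maximum norm. -/

/-! ### Norms in finite dimension, and the condition number as a least constant. -/

theorem continuous_seminorm_pi {ι : Type*} [Fintype ι] (p : Seminorm ℝ (ι → ℝ)) :
    Continuous p :=
  continuousOn_univ.1 (p.convexOn.continuousOn isOpen_univ)

theorem exists_seminorm_le_mul_norm {ι : Type*} [Fintype ι] (p : Seminorm ℝ (ι → ℝ)) :
    ∃ C, 0 ≤ C ∧ ∀ y, p y ≤ C * ‖y‖ := by
  obtain ⟨C, hC, h⟩ := Seminorm.bound_of_continuous_normedSpace p (continuous_seminorm_pi p)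
  exact ⟨C, hC.le, h⟩

theorem exists_mul_norm_le_vecNorm {ι : Type*} [Fintype ι] {μ : Seminorm ℝ (ι → ℝ)}
    (hμ : IsVecNorm μ) : ∃ c, 0 < c ∧ ∀ y, c * ‖y‖ ≤ μ y := by
  -- The unit sphere is empty exactly when `ι` is; otherwise compactness gives a positive minimum of
  -- `μ` on it.
  rcases (Metric.sphere (0 : ι → ℝ) 1).eq_empty_or_nonempty with h | h
  · refine ⟨1, one_pos, fun y => ?_⟩
    by_cases hy : y = 0
    · simp [hy]
    · have : (‖y‖⁻¹ • y) ∈ Metric.sphere (0 : ι → ℝ) 1 := by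
        simp [norm_smul, hy]
      simp [h] at this
  · obtain ⟨u, hu, hmin⟩ := (isCompact_sphere (0 : ι → ℝ) 1).exists_isMinOn h
      (continuous_seminorm_pi μ).continuousOn
    have hu0 : u ≠ 0 := by
      rintro rfl
      simp at hu
    refine ⟨μ u, lt_of_le_of_ne (apply_nonneg _ _) fun e => hu0 (hμ _ e.symm), fun y => ?_⟩
    by_cases hy : y = 0
    · simp [hy]
    · have hmem : (‖y‖⁻¹ • y) ∈ Metric.sphere (0 : ι → ℝ) 1 := by
        simp [norm_smul, hy]
      have := isMinOn_iff.1 hmin _ hmem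
      rw [map_smul_eq_mul, norm_inv, norm_norm, inv_mul_eq_div, le_div_iff₀ (norm_pos_iff.2 hy)]
        at this
      exact this

theorem ddag_ne_zero (c : ℝ) : ddag c ≠ 0 := by
  unfold ddag
  split_ifs with h
  · exact one_ne_zero
  · exact one_div_ne_zero h

theorem ddag_of_ne_zero {c : ℝ} (h : c ≠ 0) : ddag c = c⁻¹ := by simp [ddag, h]

theorem ddag_abs (c : ℝ) : ddag |c| = |ddag c| := by
  by_cases h : c = 0
  · simp [ddag, h]
  · simp [ddag, h]

theorem ddag_nonneg {c : ℝ} (h : 0 ≤ c) : 0 ≤ ddag c := by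
  unfold ddag
  split_ifs
  · exact zero_le_one
  · positivity

/-- Entry-wise division as a linear map. -/
noncomputable def entryDivLinear {ι : Type*} (β : ι → ℝ) : (ι → ℝ) →ₗ[ℝ] (ι → ℝ) where
  toFun a := entryDiv a β
  map_add' a b := by ext i; simp [entryDiv, mul_add]
  map_smul' t a := by ext i; simp [entryDiv, mul_left_comm]

theorem entryDiv_eq_zero_iff {ι : Type*} {a β : ι → ℝ} : entryDiv a β = 0 ↔ a = 0 := by
  simp [funext_iff, entryDiv, ddag_ne_zero]

theorem isVecNorm_comp_entryDiv {ι : Type*} {μ : Seminorm ℝ (ι → ℝ)} (hμ : IsVecNorm μ)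
    (β : ι → ℝ) : IsVecNorm (μ.comp (entryDivLinear β)) :=
  fun _ hy => entryDiv_eq_zero_iff.1 (hμ _ hy)

theorem smul_mem_admissible {ι : Type*} {S : Set (ι → ℝ)} {β : ι → ℝ}
    (hS : ∀ t : ℝ, ∀ Δ ∈ S, t • Δ ∈ S) (t : ℝ) {Δ : ι → ℝ}
    (hΔ : Δ ∈ admissible S β) : t • Δ ∈ admissible S β :=
  ⟨hS t _ hΔ.1, fun i hi => by simp [hΔ.2 i hi]⟩

section

variable {ι κ : Type*} [Fintype ι] [Fintype κ] {F : (ι → ℝ) → (κ → ℝ)} {F' : (ι → ℝ) →L[ℝ] (κ → ℝ)}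
  {dom S : Set (ι → ℝ)} {μ : Seminorm ℝ (ι → ℝ)} {ν : Seminorm ℝ (κ → ℝ)} {β : ι → ℝ} {ξ : κ → ℝ}
  {z : ι → ℝ}

/-- Each derivative quotient is the limit, as `t → 0+`, of the difference quotients along `t • Δ`,
and for small `t` these all compete in the supremum for `δ`. The bound therefore holds for every `δ
> 0`. -/
theorem condDerivSup_le_condSup (hdom : dom ∈ 𝓝 z) (hS : ∀ t : ℝ, ∀ Δ ∈ S, t • Δ ∈ S)
    (hF : DifferentiableAt ℝ F z) {δ : ℝ} (hδ : 0 < δ) :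
    condDerivSup F S μ ν β ξ z ≤ condSup F dom S μ ν β ξ z δ := by
  refine iSup₂_le fun Δ ⟨hΔ, hne⟩ => ?_
  set q := μ.comp (entryDivLinear β) with hq
  set p := ν.comp (entryDivLinear ξ) with hp
  have hqpos : 0 < q Δ := lt_of_le_of_ne (apply_nonneg _ _) (Ne.symm hne)
  have hinv : Tendsto (fun t : ℝ => ‖t⁻¹‖) (𝓝[>] 0) atTop :=
    (tendsto_norm_atTop_atTop).comp tendsto_inv_nhdsGT_zero
  have hlim := hF.hasFDerivAt.lim Δ hinv
  have hlim2 : Tendsto (fun t : ℝ =>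
      ENNReal.ofReal (p (t⁻¹ • (F (z + (t⁻¹)⁻¹ • Δ) - F z)) / q Δ)) (𝓝[>] 0)
      (𝓝 (ENNReal.ofReal (p (fderiv ℝ F z Δ) / q Δ))) :=
    ENNReal.tendsto_ofReal ((((continuous_seminorm_pi p).tendsto _).comp hlim).div_const _)
  refine le_of_tendsto hlim2 ?_
  have hcont : Tendsto (fun t : ℝ => z + t • Δ) (𝓝[>] 0) (𝓝 z) := by
    have : Tendsto (fun t : ℝ => z + t • Δ) (𝓝 0) (𝓝 (z + (0 : ℝ) • Δ)) :=
      Continuous.tendsto (by fun_prop) 0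
    rw [zero_smul, add_zero] at this
    exact this.mono_left nhdsWithin_le_nhds
  have hsmall : ∀ᶠ t : ℝ in 𝓝[>] 0, t * q Δ ≤ δ := by
    have : Tendsto (fun t : ℝ => t * q Δ) (𝓝 0) (𝓝 (0 * q Δ)) :=
      Continuous.tendsto (by fun_prop) 0
    rw [zero_mul] at this
    exact (this.mono_left nhdsWithin_le_nhds).eventually_le_const hδ
  filter_upwards [hcont hdom, hsmall, self_mem_nhdsWithin] with t h1 h2 (h3 : 0 < t)
  have hqt : q (t • Δ) = t * q Δ := by rw [map_smul_eq_mul, Real.norm_of_nonneg h3.le]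
  have hpt : p (t⁻¹ • (F (z + (t⁻¹)⁻¹ • Δ) - F z)) / q Δ
      = p (F (z + t • Δ) - F z) / q (t • Δ) := by
    rw [map_smul_eq_mul, Real.norm_of_nonneg (inv_nonneg.2 h3.le), hqt, inv_inv]
    field_simp
  rw [hpt]
  refine le_iSup₂_of_le (t • Δ) ⟨smul_mem_admissible hS t hΔ, h1, ?_, ?_⟩ le_rfl
  · change 0 < q (t • Δ)
    rw [hqt]
    positivity
  · change q (t • Δ) ≤ δ
    rw [hqt]
    exact h2

/-- Equivalence of norms turns the Fréchet remainder `o(‖Δ‖)` into at most `ε` times the scaled norm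
of `Δ`, uniformly in direction. -/
theorem eventually_condSup_le (hμ : IsVecNorm μ) (hF : DifferentiableAt ℝ F z) {ε : ℝ}
    (hε : 0 < ε) :
    ∀ᶠ δ in 𝓝[>] (0 : ℝ), condSup F dom S μ ν β ξ z δ
      ≤ condDerivSup F S μ ν β ξ z + ENNReal.ofReal ε := by
  set q := μ.comp (entryDivLinear β) with hq
  set p := ν.comp (entryDivLinear ξ) with hp
  obtain ⟨C, hC, hpC⟩ := exists_seminorm_le_mul_norm p
  obtain ⟨c, hc, hqc⟩ := exists_mul_norm_le_vecNorm (isVecNorm_comp_entryDiv hμ β)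
  -- `C + 1` instead of `C`, because `C` may be zero.
  have hη : 0 < ε * c / (C + 1) := by positivity
  have ho := (hasFDerivAt_iff_isLittleO_nhds_zero.1 hF.hasFDerivAt).def hη
  obtain ⟨ρ, hρ, hball⟩ := Metric.eventually_nhds_iff.1 ho
  filter_upwards [Ioo_mem_nhdsGT (show 0 < c * ρ by positivity)] with δ hδ
  refine iSup₂_le fun Δ ⟨hΔ, _, hpos, hle⟩ => ?_
  change 0 < q Δ at hpos
  change q Δ ≤ δ at hle
  change ENNReal.ofReal (p (F (z + Δ) - F z) / q Δ) ≤ _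
  have hΔρ : dist Δ 0 < ρ := by
    rw [dist_zero_right]
    have : c * ‖Δ‖ < c * ρ := ((hqc Δ).trans hle).trans_lt hδ.2
    exact lt_of_mul_lt_mul_left this hc.le
  have h1 := hball hΔρ
  have h2 : p (F (z + Δ) - F z - fderiv ℝ F z Δ) ≤ ε * q Δ := by
    calc p (F (z + Δ) - F z - fderiv ℝ F z Δ) ≤ C * (ε * c / (C + 1) * ‖Δ‖) :=
          (hpC _).trans (mul_le_mul_of_nonneg_left h1 hC)
      _ = (C / (C + 1)) * (ε * (c * ‖Δ‖)) := by ring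
      _ ≤ 1 * (ε * (c * ‖Δ‖)) := by
          refine mul_le_mul_of_nonneg_right ?_ (by positivity)
          rw [div_le_one (by positivity)]
          linarith
      _ ≤ ε * q Δ := by
          rw [one_mul]
          exact mul_le_mul_of_nonneg_left (hqc Δ) hε.le
  have h3 : p (F (z + Δ) - F z) / q Δ ≤ p (fderiv ℝ F z Δ) / q Δ + ε := by
    rw [div_add' _ _ _ hpos.ne', div_le_div_iff_of_pos_right hpos]
    have := map_add_le_add p (F (z + Δ) - F z - fderiv ℝ F z Δ) (fderiv ℝ F z Δ)
    rw [sub_add_cancel] at this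
    linarith
  refine (ENNReal.ofReal_le_ofReal h3).trans ?_
  rw [ENNReal.ofReal_add (by positivity) hε.le]
  gcongr
  exact le_iSup₂_of_le (f := fun Δ (_ : Δ ∈ {Δ | Δ ∈ admissible S β ∧ μ (entryDiv Δ β) ≠ 0}) =>
    ENNReal.ofReal (ν (entryDiv (fderiv ℝ F z Δ) ξ) / μ (entryDiv Δ β))) Δ ⟨hΔ, hpos.ne'⟩ le_rfl

theorem tendsto_condSup (hμ : IsVecNorm μ) (hdom : dom ∈ 𝓝 z)
    (hS : ∀ t : ℝ, ∀ Δ ∈ S, t • Δ ∈ S) (hF : DifferentiableAt ℝ F z) :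
    Tendsto (condSup F dom S μ ν β ξ z) (𝓝[>] 0) (𝓝 (condDerivSup F S μ ν β ξ z)) := by
  refine tendsto_order.2 ⟨fun a ha => ?_, fun a ha => ?_⟩
  · filter_upwards [self_mem_nhdsWithin] with δ hδ
    exact ha.trans_le (condDerivSup_le_condSup hdom hS hF hδ)
  · obtain ⟨r, hr, hlt⟩ := ENNReal.lt_iff_exists_add_pos_lt.1 ha
    filter_upwards [eventually_condSup_le (dom := dom) (S := S) (ν := ν) (β := β) (ξ := ξ) hμ hF
      (NNReal.coe_pos.2 hr)] with δ hδ
    refine hδ.trans_lt ?_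
    rwa [ENNReal.ofReal_coe_nnreal]

/-- A condition number is the least Lipschitz constant of the derivative, for the scaled norms. -/
theorem isCondNumber_of_isLeast (hμ : IsVecNorm μ) (hdom : IsOpen dom) (hz : z ∈ dom)
    (hS : ∀ t : ℝ, ∀ Δ ∈ S, t • Δ ∈ S) (hF : HasFDerivAt F F' z) {c : ℝ}
    (hc : IsLeast {c : ℝ | 0 ≤ c ∧
      ∀ Δ ∈ admissible S β, ν (entryDiv (F' Δ) ξ) ≤ c * μ (entryDiv Δ β)} c) :
    IsCondNumber F dom S μ ν β ξ z c := by
  have hderiv : condDerivSup F S μ ν β ξ z = ENNReal.ofReal c := by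
    have hle : condDerivSup F S μ ν β ξ z ≤ ENNReal.ofReal c := by
      refine iSup₂_le fun Δ ⟨hΔ, hne⟩ => ENNReal.ofReal_le_ofReal ?_
      rw [hF.fderiv, div_le_iff₀ (lt_of_le_of_ne (apply_nonneg _ _) (Ne.symm hne))]
      exact hc.1.2 Δ hΔ
    refine le_antisymm hle ?_
    -- Being finite, the supremum is itself an admissible constant, so minimality of `c` applies to
    -- it.
    have hfin : condDerivSup F S μ ν β ξ z ≠ ⊤ := (hle.trans_lt ENNReal.ofReal_lt_top).ne
    rw [← ENNReal.ofReal_toReal hfin]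
    refine ENNReal.ofReal_le_ofReal (hc.2 ⟨ENNReal.toReal_nonneg, fun Δ hΔ => ?_⟩)
    by_cases hne : μ (entryDiv Δ β) = 0
    · have : Δ = 0 := entryDiv_eq_zero_iff.1 (hμ _ hne)
      subst this
      have h0 : entryDiv (F' 0) ξ = 0 := by rw [map_zero, entryDiv_eq_zero_iff]
      rw [h0, map_zero, hne, mul_zero]
    · rw [← div_le_iff₀ (lt_of_le_of_ne (apply_nonneg _ _) (Ne.symm hne)),
        ← ENNReal.ofReal_le_iff_le_toReal hfin, ← hF.fderiv]
      exact le_iSup₂_of_le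
        (f := fun Δ (_ : Δ ∈ {Δ | Δ ∈ admissible S β ∧ μ (entryDiv Δ β) ≠ 0}) =>
          ENNReal.ofReal (ν (entryDiv (fderiv ℝ F z Δ) ξ) / μ (entryDiv Δ β))) Δ ⟨hΔ, hne⟩ le_rfl
  exact ⟨hz, hF.differentiableAt,
    hderiv ▸ tendsto_condSup hμ (hdom.mem_nhds hz) hS hF.differentiableAt, hderiv⟩

end

/-- In this form two norm formulas can be identified by comparing their sets of bounds. It also
covers an empty `ι`, where the supremum over the empty set is `0`. -/
theorem isLeast_inducedNorm {ι κ : Type*} [Fintype ι] {μ : Seminorm ℝ (ι → ℝ)} (hμ : IsVecNorm μ)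
    (ν : Seminorm ℝ (κ → ℝ)) (N : Matrix κ ι ℝ) :
    IsLeast {c : ℝ | 0 ≤ c ∧ ∀ y, ν (N *ᵥ y) ≤ c * μ y} (inducedNorm μ ν N) := by
  have hpos : ∀ y, y ≠ 0 → 0 < μ y := fun y hy =>
    lt_of_le_of_ne (apply_nonneg _ _) fun e => hy (hμ _ e.symm)
  obtain ⟨C, hC, hνC⟩ := exists_seminorm_le_mul_norm (ν.comp N.mulVecLin)
  obtain ⟨c, hc, hμc⟩ := exists_mul_norm_le_vecNorm hμ
  have hbdd : BddAbove {t : ℝ | ∃ y : ι → ℝ, y ≠ 0 ∧ t = ν (N *ᵥ y) / μ y} := by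
    refine ⟨C / c, ?_⟩
    rintro _ ⟨y, hy, rfl⟩
    rw [div_le_div_iff₀ (hpos y hy) hc]
    calc ν (N *ᵥ y) * c ≤ (C * ‖y‖) * c := mul_le_mul_of_nonneg_right (hνC y) hc.le
      _ = C * (c * ‖y‖) := by ring
      _ ≤ C * μ y := mul_le_mul_of_nonneg_left (hμc y) hC
  refine ⟨⟨?_, fun y => ?_⟩, fun c' ⟨hc0, hc'⟩ => ?_⟩
  · refine Real.sSup_nonneg ?_
    rintro _ ⟨y, -, rfl⟩
    positivity
  · by_cases hy : y = 0
    · simp [hy]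
    · rw [← div_le_iff₀ (hpos y hy)]
      exact le_csSup hbdd ⟨y, hy, rfl⟩
  · refine Real.sSup_le ?_ hc0
    rintro _ ⟨y, hy, rfl⟩
    rw [div_le_iff₀ (hpos y hy)]
    exact hc' y

/-! ### The smallest singular value: Rayleigh bound, eigenvector, continuity. -/

section

variable {E G : Type*} [NormedAddCommGroup E] [InnerProductSpace ℝ E] [FiniteDimensional ℝ E]
  [NormedAddCommGroup G] [InnerProductSpace ℝ G] [FiniteDimensional ℝ G]

/-- The smallest singular value bounds the Rayleigh quotient from below. -/
theorem sq_singularValues_last_mul_le (T : E →ₗ[ℝ] G) {d : ℕ} (hd : Module.finrank ℝ E = d + 1)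
    (v : E) : T.singularValues d ^ 2 * ‖v‖ ^ 2 ≤ ‖T v‖ ^ 2 := by
  set hT := T.isSymmetric_adjoint_comp_self
  set e := hT.eigenvectorBasis hd
  have h1 : ‖T v‖ ^ 2 = ∑ i, hT.eigenvalues hd i * ‖inner ℝ (e i) v‖ ^ 2 := by
    rw [← real_inner_self_eq_norm_sq, ← LinearMap.adjoint_inner_left, ← e.sum_inner_mul_inner]
    refine Finset.sum_congr rfl fun i _ => ?_
    have h2 : inner ℝ ((LinearMap.adjoint T) (T v)) (e i)
        = hT.eigenvalues hd i * inner ℝ (e i) v := by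
      have := hT v (e i)
      simp only [LinearMap.comp_apply] at this
      rw [this, ← LinearMap.comp_apply, hT.apply_eigenvectorBasis, inner_smul_right,
        real_inner_comm]
      rfl
    rw [h2, Real.norm_eq_abs, sq_abs]
    ring
  rw [h1, ← e.sum_sq_norm_inner_right v, Finset.mul_sum]
  refine Finset.sum_le_sum fun i _ => mul_le_mul_of_nonneg_right ?_ (sq_nonneg _)
  rw [T.sq_singularValues_of_lt hd (Nat.lt_succ_self d)]
  exact hT.eigenvalues_antitone hd (Fin.le_def.2 (Nat.le_of_lt_succ i.2))

theorem exists_singularValues_last_eigenvector (T : E →ₗ[ℝ] G) {d : ℕ}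
    (hd : Module.finrank ℝ E = d + 1) :
    ∃ v, v ≠ 0 ∧ LinearMap.adjoint T (T v) = T.singularValues d ^ 2 • v := by
  obtain ⟨v, hv⟩ := (T.hasEigenvalue_adjoint_comp_self_sq_singularValues
    (n := d) (by omega)).exists_hasEigenvector
  exact ⟨v, hv.2, hv.apply_eq_smul⟩

theorem exists_norm_apply_eq_singularValues_last (T : E →ₗ[ℝ] G) {d : ℕ}
    (hd : Module.finrank ℝ E = d + 1) :
    ∃ v, ‖v‖ = 1 ∧ ‖T v‖ = T.singularValues d := by
  obtain ⟨v, hv0, hv⟩ := exists_singularValues_last_eigenvector T hd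
  have h1 : ‖T v‖ = T.singularValues d * ‖v‖ := by
    rw [← sq_eq_sq₀ (norm_nonneg _) (mul_nonneg (T.singularValues_nonneg d) (norm_nonneg _)),
      ← real_inner_self_eq_norm_sq, ← LinearMap.adjoint_inner_left, hv, real_inner_smul_left,
      real_inner_self_eq_norm_sq, mul_pow]
  have hn : ‖v‖ ≠ 0 := norm_ne_zero_iff.2 hv0
  refine ⟨‖v‖⁻¹ • v, by simp [norm_smul, hn], ?_⟩
  rw [map_smul, norm_smul, h1, norm_inv, norm_norm]
  field_simp

theorem singularValues_last_le_norm_apply (T : E →ₗ[ℝ] G) {d : ℕ}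
    (hd : Module.finrank ℝ E = d + 1) {v : E} (hv : ‖v‖ = 1) : T.singularValues d ≤ ‖T v‖ := by
  have := sq_singularValues_last_mul_le T hd v
  rw [hv, one_pow, mul_one] at this
  exact le_of_sq_le_sq this (norm_nonneg _)

/-- The smallest singular value is a nonexpansive function of the operator. -/
theorem continuous_singularValues_last {d : ℕ} (hd : Module.finrank ℝ E = d + 1) :
    Continuous fun T : E →L[ℝ] G => (T : E →ₗ[ℝ] G).singularValues d := by
  have key : ∀ T T' : E →L[ℝ] G, (T : E →ₗ[ℝ] G).singularValues d
      ≤ (T' : E →ₗ[ℝ] G).singularValues d + ‖T - T'‖ := fun T T' => by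
    -- A unit vector that is optimal for `T'` serves as a test vector for `T`.
    obtain ⟨v, hv, hv'⟩ := exists_norm_apply_eq_singularValues_last (T' : E →ₗ[ℝ] G) hd
    have h1 := singularValues_last_le_norm_apply (T : E →ₗ[ℝ] G) hd hv
    have h2 := (T - T').le_opNorm v
    rw [hv, mul_one] at h2
    have h3 : T v = T' v + (T - T') v := by simp
    calc _ ≤ ‖T v‖ := h1
      _ ≤ ‖T' v‖ + ‖(T - T') v‖ := h3 ▸ norm_add_le _ _
      _ ≤ _ := add_le_add hv'.le h2
  refine (LipschitzWith.of_dist_le_mul (K := 1) fun T T' => ?_).continuous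
  rw [NNReal.coe_one, one_mul, dist_eq_norm, dist_eq_norm, Real.norm_eq_abs, abs_le]
  have h1 := key T T'
  have h2 := key T' T
  rw [norm_sub_rev] at h2
  constructor <;> linarith

end

section

variable {m κ : Type*} [Fintype m] [Fintype κ] [DecidableEq κ] {d : ℕ}

theorem sq_norm_toLp_two {ι : Type*} [Fintype ι] (v : ι → ℝ) :
    ‖(WithLp.toLp 2 v : EuclideanSpace ℝ ι)‖ ^ 2 = v ⬝ᵥ v := by
  rw [EuclideanSpace.real_norm_sq_eq]
  simp [dotProduct, sq]

theorem sq_singularValues_mul_dotProduct_le (C : Matrix m κ ℝ) (hd : Fintype.card κ = d + 1)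
    (v : κ → ℝ) :
    (Matrix.toEuclideanLin C).singularValues d ^ 2 * (v ⬝ᵥ v) ≤ (C *ᵥ v) ⬝ᵥ (C *ᵥ v) := by
  have := sq_singularValues_last_mul_le (Matrix.toEuclideanLin C) (d := d) (by simpa using hd)
    (WithLp.toLp 2 v)
  rwa [Matrix.toLpLin_apply, sq_norm_toLp_two, sq_norm_toLp_two] at this

theorem exists_transpose_mulVec_mulVec_eq [DecidableEq m] (C : Matrix m κ ℝ) (hd : Fintype.card κ = d + 1) :
    ∃ v : κ → ℝ, v ≠ 0 ∧
      Cᵀ *ᵥ (C *ᵥ v) = (Matrix.toEuclideanLin C).singularValues d ^ 2 • v := by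
  obtain ⟨v, hv0, hv⟩ := exists_singularValues_last_eigenvector (Matrix.toEuclideanLin C)
    (d := d) (by simpa using hd)
  refine ⟨v.ofLp, fun h => hv0 (by ext i; simp [h]), ?_⟩
  rw [← Matrix.toEuclideanLin_conjTranspose_eq_adjoint, Matrix.conjTranspose_eq_transpose_of_trivial,
    Matrix.toLpLin_apply, Matrix.toLpLin_apply] at hv
  exact congrArg WithLp.ofLp hv

/-- The linear parametrisation `f` lets this serve both `A` and `[A, b]` as functions of the data
vector. -/
theorem continuous_singularValues_toEuclideanLin {V : Type*} [NormedAddCommGroup V]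
    [NormedSpace ℝ V] [FiniteDimensional ℝ V] (f : V →ₗ[ℝ] Matrix m κ ℝ)
    (hd : Fintype.card κ = d + 1) :
    Continuous fun z => (Matrix.toEuclideanLin (f z)).singularValues d := by
  let Λ : V →ₗ[ℝ] (EuclideanSpace ℝ κ →L[ℝ] EuclideanSpace ℝ m) :=
    LinearMap.toContinuousLinearMap.toLinearMap ∘ₗ
      (Matrix.toEuclideanLin (𝕜 := ℝ)).toLinearMap ∘ₗ f
  have hΛ : Continuous Λ := Λ.continuous_of_finiteDimensional
  have h := continuous_singularValues_last (E := EuclideanSpace ℝ κ) (G := EuclideanSpace ℝ m)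
    (d := d) (by simpa using hd)
  refine (h.comp hΛ).congr fun z => ?_
  have hz : ((Λ z : EuclideanSpace ℝ κ →L[ℝ] EuclideanSpace ℝ m) :
      EuclideanSpace ℝ κ →ₗ[ℝ] EuclideanSpace ℝ m) = Matrix.toEuclideanLin (f z) :=
    LinearMap.coe_toContinuousLinearMap _
  rw [Function.comp_apply, hz]

end

/-! ### Algebra of the total least squares solution and its two variational characterisations. -/

/-- For `n = 0` the truncated index `n - 1` is `0`, beyond the last singular value, so `sigmaMin A`
is `0` and cannot exceed a nonnegative number. -/
theorem exists_eq_succ_of_sigmaTilde_lt {m n : ℕ} {A : Matrix (Fin m) (Fin n) ℝ} {b : Fin m → ℝ}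
    (hσ : sigmaTilde A b < sigmaMin A) : ∃ d, n = d + 1 := by
  rcases n with _ | d
  · have h : sigmaMin A = 0 := LinearMap.singularValues_of_finrank_le _ (by simp)
    have h2 : 0 ≤ sigmaTilde A b := LinearMap.singularValues_nonneg _ _
    linarith
  · exact ⟨d, rfl⟩

section

variable {m n : ℕ} (A : Matrix (Fin m) (Fin n) ℝ) (b : Fin m → ℝ)

theorem sigmaTilde_nonneg : 0 ≤ sigmaTilde A b := LinearMap.singularValues_nonneg _ _

theorem augment_mulVec (v : Fin n ⊕ Unit → ℝ) :
    augment A b *ᵥ v = A *ᵥ (v ∘ Sum.inl) + v (Sum.inr ()) • b := by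
  rw [augment, Matrix.fromCols_mulVec]
  congr 1
  ext i
  simp [Matrix.mulVec, dotProduct, mul_comm]

theorem augment_transpose_mulVec (r : Fin m → ℝ) :
    (augment A b)ᵀ *ᵥ r = Sum.elim (Aᵀ *ᵥ r) (fun _ => b ⬝ᵥ r) := by
  ext (i | i) <;> simp [augment, Matrix.mulVec, dotProduct, Matrix.fromCols]

theorem tlsM_eq : tlsM A b = Aᵀ * A - sigmaTilde A b ^ 2 • (1 : Matrix (Fin n) (Fin n) ℝ) := by
  rw [tlsM, stackA, stackJ, Matrix.transpose_fromRows, Matrix.fromCols_mul_fromBlocks,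
    Matrix.fromCols_mul_fromRows]
  simp [sq, smul_smul, sub_eq_add_neg]

theorem tlsM_mulVec (y : Fin n → ℝ) :
    tlsM A b *ᵥ y = Aᵀ *ᵥ (A *ᵥ y) - sigmaTilde A b ^ 2 • y := by
  rw [tlsM_eq, Matrix.sub_mulVec, Matrix.smul_mulVec, Matrix.one_mulVec, Matrix.mulVec_mulVec]

theorem dotProduct_tlsM_mulVec (y : Fin n → ℝ) :
    y ⬝ᵥ tlsM A b *ᵥ y = (A *ᵥ y) ⬝ᵥ (A *ᵥ y) - sigmaTilde A b ^ 2 * (y ⬝ᵥ y) := by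
  rw [tlsM_mulVec, dotProduct_sub, dotProduct_smul, Matrix.dotProduct_mulVec,
    Matrix.vecMul_transpose, smul_eq_mul]

theorem tlsX_eq : tlsX A b = (tlsM A b)⁻¹ *ᵥ (Aᵀ *ᵥ b) := by
  rw [tlsX, ilsSolution]
  change (tlsM A b)⁻¹ *ᵥ _ = _
  congr 1
  rw [stackA, stackJ, stackB, Matrix.transpose_fromRows, Matrix.fromBlocks_mulVec]
  simp [Matrix.fromCols_mulVec]

theorem ilsObjective_stack (y : Fin n → ℝ) :
    ilsObjective (stackJ m n) (stackA A b) (stackB n b) y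
      = (b - A *ᵥ y) ⬝ᵥ (b - A *ᵥ y) - sigmaTilde A b ^ 2 * (y ⬝ᵥ y) := by
  have h : stackB n b - stackA A b *ᵥ y = Sum.elim (b - A *ᵥ y) (-(sigmaTilde A b • y)) := by
    ext (i | i) <;> simp [stackA, stackB, Matrix.smul_mulVec]
  rw [ilsObjective, h, stackJ, Matrix.fromBlocks_mulVec]
  simp [Matrix.neg_mulVec]
  ring

variable {A b} (hσ : sigmaTilde A b < sigmaMin A)
include hσ

theorem sq_sigmaMin_mul_dotProduct_le (y : Fin n → ℝ) :
    sigmaMin A ^ 2 * (y ⬝ᵥ y) ≤ (A *ᵥ y) ⬝ᵥ (A *ᵥ y) := by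
  obtain ⟨d, rfl⟩ := exists_eq_succ_of_sigmaTilde_lt hσ
  exact sq_singularValues_mul_dotProduct_le A (by simp) y

theorem posDef_tlsM : (tlsM A b).PosDef := by
  refine Matrix.PosDef.of_dotProduct_mulVec_pos ?_ fun y hy => ?_
  · rw [Matrix.IsHermitian, Matrix.conjTranspose_eq_transpose_of_trivial, tlsM_eq]
    simp
  · rw [star_trivial, dotProduct_tlsM_mulVec]
    have h1 := sq_sigmaMin_mul_dotProduct_le hσ y
    have h2 : 0 < y ⬝ᵥ y := lt_of_le_of_ne (by simpa using dotProduct_star_self_nonneg y)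
      fun e => hy (dotProduct_self_eq_zero.1 e.symm)
    have h3 : sigmaTilde A b ^ 2 < sigmaMin A ^ 2 :=
      pow_lt_pow_left₀ hσ (sigmaTilde_nonneg A b) two_ne_zero
    nlinarith

theorem isUnit_det_tlsM : IsUnit (tlsM A b).det := (posDef_tlsM hσ).det_pos.ne'.isUnit

theorem eq_tlsX_of_tlsM_mulVec {y : Fin n → ℝ} (h : tlsM A b *ᵥ y = Aᵀ *ᵥ b) : y = tlsX A b := by
  rw [tlsX_eq, ← h, Matrix.mulVec_mulVec, Matrix.nonsing_inv_mul _ (isUnit_det_tlsM hσ),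
    Matrix.one_mulVec]

theorem tlsM_mulVec_tlsX : tlsM A b *ᵥ tlsX A b = Aᵀ *ᵥ b := by
  rw [tlsX_eq, Matrix.mulVec_mulVec, Matrix.mul_nonsing_inv _ (isUnit_det_tlsM hσ),
    Matrix.one_mulVec]

/-- The gradient equation of the total least squares problem. -/
theorem transpose_mulVec_tlsR : Aᵀ *ᵥ tlsR A b = -(sigmaTilde A b ^ 2 • tlsX A b) := by
  have := tlsM_mulVec_tlsX hσ
  rw [tlsM_mulVec] at this
  rw [tlsR, Matrix.mulVec_sub, ← this]
  abel

/-- The last row of the eigenvector equation for `[A, b]ᵀ [A, b]`. -/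
theorem dotProduct_tlsR : b ⬝ᵥ tlsR A b = sigmaTilde A b ^ 2 := by
  obtain ⟨v, hv0, hv⟩ := exists_transpose_mulVec_mulVec_eq (augment A b) (d := n) (by simp)
  change _ = sigmaTilde A b ^ 2 • v at hv
  rw [augment_transpose_mulVec, augment_mulVec] at hv
  have h1 : Aᵀ *ᵥ (A *ᵥ (v ∘ Sum.inl)) + v (Sum.inr ()) • Aᵀ *ᵥ b
      = sigmaTilde A b ^ 2 • (v ∘ Sum.inl) := by
    rw [← Matrix.mulVec_smul, ← Matrix.mulVec_add]
    ext j
    exact congrFun hv (Sum.inl j)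
  have h2 : b ⬝ᵥ (A *ᵥ (v ∘ Sum.inl) + v (Sum.inr ()) • b)
      = sigmaTilde A b ^ 2 * v (Sum.inr ()) := congrFun hv (Sum.inr ())
  -- With last coordinate zero, the other coordinates would lie in the kernel of `M̃`, and the
  -- eigenvector would vanish.
  have ht : v (Sum.inr ()) ≠ 0 := fun ht => by
    rw [ht, zero_smul, add_zero] at h1
    have h3 : tlsM A b *ᵥ (v ∘ Sum.inl) = 0 := by rw [tlsM_mulVec, h1, sub_self]
    have h4 : v ∘ Sum.inl = 0 := by
      rw [← Matrix.one_mulVec (v ∘ Sum.inl), ← Matrix.nonsing_inv_mul _ (isUnit_det_tlsM hσ),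
        ← Matrix.mulVec_mulVec, h3, Matrix.mulVec_zero]
    refine hv0 (funext fun i => ?_)
    rcases i with j | j
    · exact congrFun h4 j
    · exact ht
  -- The eigenvector is thus a multiple of `(x, -1)`, and `[A, b]` maps it to a multiple of `r`.
  have hx : v ∘ Sum.inl = -v (Sum.inr ()) • tlsX A b := by
    rw [← eq_tlsX_of_tlsM_mulVec hσ (y := -(v (Sum.inr ()))⁻¹ • (v ∘ Sum.inl)), smul_smul]
    · field_simp
      simp
    · rw [Matrix.mulVec_smul, tlsM_mulVec, ← h1, sub_add_cancel_left, neg_smul, smul_neg, neg_neg,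
        smul_smul, inv_mul_cancel₀ ht, one_smul]
  have h5 : A *ᵥ (v ∘ Sum.inl) + v (Sum.inr ()) • b = v (Sum.inr ()) • tlsR A b := by
    rw [hx, Matrix.mulVec_smul, tlsR, smul_sub, neg_smul]
    abel
  rw [h5, dotProduct_smul, smul_eq_mul, mul_comm] at h2
  exact mul_right_cancel₀ ht h2

/-- Completing the square about `x`: the linear term vanishes by `Aᵀr = -σ̃² x`, and the constant is
`σ̃²` because `rᵀr = σ̃²(1 + xᵀx)`. -/
theorem ilsObjective_stack_eq (y : Fin n → ℝ) :
    ilsObjective (stackJ m n) (stackA A b) (stackB n b) y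
      = sigmaTilde A b ^ 2 + (y - tlsX A b) ⬝ᵥ tlsM A b *ᵥ (y - tlsX A b) := by
  obtain ⟨h, rfl⟩ : ∃ h, y = tlsX A b + h := ⟨y - tlsX A b, by abel⟩
  have h1 := dotProduct_tlsR hσ
  have h2 := transpose_mulVec_tlsR hσ
  have h3 : ∀ w, (A *ᵥ w) ⬝ᵥ tlsR A b = -(sigmaTilde A b ^ 2 * (w ⬝ᵥ tlsX A b)) := fun w => by
    rw [dotProduct_comm, Matrix.dotProduct_mulVec, ← Matrix.mulVec_transpose, h2,
      neg_dotProduct, smul_dotProduct, dotProduct_comm w, smul_eq_mul]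
  have h4 : b - A *ᵥ (tlsX A b + h) = tlsR A b - A *ᵥ h := by
    rw [Matrix.mulVec_add, tlsR]
    abel
  have h5 : tlsR A b ⬝ᵥ tlsR A b
      = sigmaTilde A b ^ 2 + sigmaTilde A b ^ 2 * (tlsX A b ⬝ᵥ tlsX A b) := by
    calc tlsR A b ⬝ᵥ tlsR A b = (b - A *ᵥ tlsX A b) ⬝ᵥ tlsR A b := rfl
      _ = _ := by rw [sub_dotProduct, h1, h3]; ring
  rw [ilsObjective_stack, h4, add_sub_cancel_left, dotProduct_tlsM_mulVec]
  simp only [sub_dotProduct, dotProduct_sub, dotProduct_add, add_dotProduct, h5, h3,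
    dotProduct_comm (tlsR A b) (A *ᵥ h), dotProduct_comm (tlsX A b) h]
  ring

theorem ilsObjective_stack_le_iff (y : Fin n → ℝ) :
    ilsObjective (stackJ m n) (stackA A b) (stackB n b) y ≤ sigmaTilde A b ^ 2 ↔
      y = tlsX A b := by
  rw [ilsObjective_stack_eq hσ]
  refine ⟨fun h => ?_, fun h => by simp [h]⟩
  by_contra hne
  have := (posDef_tlsM hσ).dotProduct_mulVec_pos (sub_ne_zero.2 hne)
  rw [star_trivial] at this
  linarith

theorem isILSSolution_iff (y : Fin n → ℝ) :
    IsILSSolution (stackJ m n) (stackA A b) (stackB n b) y ↔ y = tlsX A b := by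
  have hx : ilsObjective (stackJ m n) (stackA A b) (stackB n b) (tlsX A b)
      = sigmaTilde A b ^ 2 := by simp [ilsObjective_stack_eq hσ]
  constructor
  · intro h
    exact (ilsObjective_stack_le_iff hσ y).1 (hx ▸ h (tlsX A b))
  · rintro rfl y
    rw [hx, ilsObjective_stack_eq hσ]
    have := (posDef_tlsM hσ).posSemidef.dotProduct_mulVec_nonneg (y - tlsX A b)
    rw [star_trivial] at this
    linarith

omit hσ in
theorem frobNorm_sq {ι κ : Type*} [Fintype ι] [Fintype κ] (C : Matrix ι κ ℝ) :
    frobNorm C ^ 2 = ∑ i, ∑ j, C i j ^ 2 :=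
  Real.sq_sqrt (Finset.sum_nonneg fun _ _ => Finset.sum_nonneg fun _ _ => sq_nonneg _)

-- Cauchy–Schwarz in each row.
omit hσ in
theorem mulVec_dotProduct_mulVec_le_frobNorm {ι κ : Type*} [Fintype ι] [Fintype κ]
    (C : Matrix ι κ ℝ) (v : κ → ℝ) :
    (C *ᵥ v) ⬝ᵥ (C *ᵥ v) ≤ frobNorm C ^ 2 * (v ⬝ᵥ v) := by
  rw [frobNorm_sq, Finset.sum_mul]
  refine Finset.sum_le_sum fun i _ => ?_
  have := Finset.sum_mul_sq_le_sq_mul_sq Finset.univ (C i) v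
  simpa [Matrix.mulVec, dotProduct, ← sq] using this

omit hσ in
theorem dotProduct_homogeneous (y : Fin n → ℝ) :
    (Sum.elim y fun _ : Unit => (-1 : ℝ)) ⬝ᵥ (Sum.elim y fun _ : Unit => (-1 : ℝ))
      = y ⬝ᵥ y + 1 := by
  simp [dotProduct]

omit hσ in
theorem augment_mulVec_homogeneous (E : Matrix (Fin m) (Fin n) ℝ) (ε : Fin m → ℝ)
    (y : Fin n → ℝ) :
    augment E ε *ᵥ (Sum.elim y fun _ : Unit => (-1 : ℝ)) = E *ᵥ y - ε := by
  rw [augment_mulVec]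
  simp [sub_eq_add_neg]

-- Consistency says that `[E, ε]` maps `(y, -1)` to the residual `b - Ay`.
omit hσ in
theorem residual_le_of_consistent {E : Matrix (Fin m) (Fin n) ℝ} {ε : Fin m → ℝ}
    {y : Fin n → ℝ} (h : (A + E) *ᵥ y = b + ε) :
    (b - A *ᵥ y) ⬝ᵥ (b - A *ᵥ y) ≤ frobNorm (augment E ε) ^ 2 * (y ⬝ᵥ y + 1) := by
  have h1 : b - A *ᵥ y = augment E ε *ᵥ (Sum.elim y fun _ : Unit => (-1 : ℝ)) := by
    rw [augment_mulVec_homogeneous, ← sub_eq_zero]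
    rw [Matrix.add_mulVec] at h
    linear_combination (exp := 1) -h
  rw [h1, ← dotProduct_homogeneous]
  exact mulVec_dotProduct_mulVec_le_frobNorm _ _

/-- Nonnegativity of the completed square gives `σ̃²(1 + ‖y‖²) ≤ ‖b - Ay‖²`; compare with the upper
bound from consistency. -/
theorem sq_sigmaTilde_le_frobNorm {E : Matrix (Fin m) (Fin n) ℝ} {ε : Fin m → ℝ}
    {y : Fin n → ℝ} (h : (A + E) *ᵥ y = b + ε) :
    sigmaTilde A b ^ 2 ≤ frobNorm (augment E ε) ^ 2 := by
  have h1 := residual_le_of_consistent h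
  have h2 := ilsObjective_stack_eq hσ y
  rw [ilsObjective_stack] at h2
  have h3 := (posDef_tlsM hσ).posSemidef.dotProduct_mulVec_nonneg (y - tlsX A b)
  rw [star_trivial] at h3
  have h4 : 0 ≤ y ⬝ᵥ y := by simpa using dotProduct_star_self_nonneg y
  nlinarith

theorem exists_consistent_tlsX : ∃ (E : Matrix (Fin m) (Fin n) ℝ) (ε : Fin m → ℝ),
    (A + E) *ᵥ tlsX A b = b + ε ∧ frobNorm (augment E ε) ^ 2 = sigmaTilde A b ^ 2 := by
  set x := tlsX A b with hx
  set r := tlsR A b with hr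
  have hpos : 0 < x ⬝ᵥ x + 1 := by
    have : 0 ≤ x ⬝ᵥ x := by simpa using dotProduct_star_self_nonneg x
    linarith
  have hrr : r ⬝ᵥ r = sigmaTilde A b ^ 2 * (x ⬝ᵥ x + 1) := by
    have h2 := ilsObjective_stack_eq hσ x
    rw [ilsObjective_stack, hx, sub_self, Matrix.mulVec_zero, dotProduct_zero] at h2
    change r ⬝ᵥ r - _ = _ at h2
    linarith
  -- `[E, ε]` is the rank-one matrix `r (x, -1)ᵀ / (1 + ‖x‖²)`, the equality case of Cauchy–Schwarz.
  refine ⟨(x ⬝ᵥ x + 1)⁻¹ • Matrix.vecMulVec r x, -(x ⬝ᵥ x + 1)⁻¹ • r, ?_, ?_⟩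
  · rw [Matrix.add_mulVec, Matrix.smul_mulVec]
    ext i
    have h1 : r i = b i - (A *ᵥ x) i := rfl
    have h2 : (Matrix.vecMulVec r x *ᵥ x) i = r i * (x ⬝ᵥ x) := by
      simp [Matrix.mulVec, dotProduct, Matrix.vecMulVec_apply, Finset.mul_sum, mul_assoc]
    simp only [Pi.add_apply, Pi.smul_apply, smul_eq_mul, h2]
    field_simp
    rw [h1]
    ring
  · rw [frobNorm_sq]
    have h1 : ∀ i, ∑ j, augment ((x ⬝ᵥ x + 1)⁻¹ • Matrix.vecMulVec r x)
        (-(x ⬝ᵥ x + 1)⁻¹ • r) i j ^ 2 = (x ⬝ᵥ x + 1)⁻¹ * (r i * r i) := fun i => by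
      rw [Fintype.sum_sum_type]
      simp only [augment, Matrix.fromCols_apply_inl, Matrix.fromCols_apply_inr, Matrix.smul_apply,
        Matrix.vecMulVec_apply, Matrix.replicateCol_apply, Pi.smul_apply, smul_eq_mul,
        Finset.univ_unique, Finset.sum_singleton]
      have h2 : ∑ j, ((x ⬝ᵥ x + 1)⁻¹ * (r i * x j)) ^ 2
          = (x ⬝ᵥ x + 1)⁻¹ ^ 2 * r i ^ 2 * (x ⬝ᵥ x) := by
        rw [dotProduct, Finset.mul_sum]
        exact Finset.sum_congr rfl fun j _ => by ring
      rw [h2]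
      field_simp
    rw [Finset.sum_congr rfl fun i _ => h1 i, ← Finset.mul_sum]
    change _ * (r ⬝ᵥ r) = _
    rw [hrr]
    field_simp

theorem isTLSSolution_iff (y : Fin n → ℝ) : IsTLSSolution A b y ↔ y = tlsX A b := by
  obtain ⟨E₀, ε₀, h₀, hf₀⟩ := exists_consistent_tlsX hσ
  constructor
  · rintro ⟨E, ε, h, hmin⟩
    -- Uniqueness is inherited from the indefinite problem: an optimal perturbation has squared norm
    -- at most `σ̃²`, which pushes the indefinite objective at `y` down to its minimum.
    rw [← ilsObjective_stack_le_iff hσ, ilsObjective_stack]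
    have h1 := residual_le_of_consistent h
    have h2 : frobNorm (augment E ε) ^ 2 ≤ sigmaTilde A b ^ 2 := by
      rw [← hf₀]
      exact pow_le_pow_left₀ (Real.sqrt_nonneg _) (hmin _ _ _ h₀) 2
    have h4 : 0 ≤ y ⬝ᵥ y := by simpa using dotProduct_star_self_nonneg y
    nlinarith
  · rintro rfl
    refine ⟨E₀, ε₀, h₀, fun E' ε' x' h' => ?_⟩
    have := sq_sigmaTilde_le_frobNorm hσ h'
    rw [← hf₀] at this
    exact le_of_sq_le_sq this (Real.sqrt_nonneg _)

end

/-! ### Openness of the domain and continuity of the solution. -/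

theorem isOpen_tlsDomain (m n : ℕ) : IsOpen (tlsDomain m n) := by
  rcases n with _ | d
  · have : tlsDomain m 0 = ∅ := by
      refine Set.eq_empty_of_forall_notMem fun z hz => ?_
      obtain ⟨d, hd⟩ := exists_eq_succ_of_sigmaTilde_lt hz
      omega
    rw [this]
    exact isOpen_empty
  · let f : (DataIdx m (d + 1) → ℝ) →ₗ[ℝ] Matrix (Fin m) (Fin (d + 1)) ℝ :=
      { toFun := dataMat, map_add' := fun _ _ => rfl, map_smul' := fun _ _ => rfl }
    let g : (DataIdx m (d + 1) → ℝ) →ₗ[ℝ] Matrix (Fin m) (Fin (d + 1) ⊕ Unit) ℝ :=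
      { toFun := fun z => augment (dataMat z) (dataRhs z)
        map_add' := fun _ _ => by ext i (j | j) <;> rfl
        map_smul' := fun _ _ => by ext i (j | j) <;> rfl }
    exact isOpen_lt (continuous_singularValues_toEuclideanLin g (by simp))
      (continuous_singularValues_toEuclideanLin f (by simp))

theorem continuous_sigmaTilde (m n : ℕ) :
    Continuous fun z : DataIdx m n → ℝ => sigmaTilde (dataMat z) (dataRhs z) := by
  let g : (DataIdx m n → ℝ) →ₗ[ℝ] Matrix (Fin m) (Fin n ⊕ Unit) ℝ :=
    { toFun := fun z => augment (dataMat z) (dataRhs z)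
      map_add' := fun _ _ => by ext i (j | j) <;> rfl
      map_smul' := fun _ _ => by ext i (j | j) <;> rfl }
  exact continuous_singularValues_toEuclideanLin g (by simp)

theorem continuous_dataMat (m n : ℕ) :
    Continuous (dataMat : (DataIdx m n → ℝ) → Matrix (Fin m) (Fin n) ℝ) :=
  continuous_matrix fun i j => continuous_apply (Sum.inl (j, i))

theorem continuous_dataRhs (m n : ℕ) :
    Continuous (dataRhs : (DataIdx m n → ℝ) → Fin m → ℝ) :=
  continuous_pi fun i => continuous_apply (Sum.inr i)

theorem differentiable_dataMat_apply {m n : ℕ} (i : Fin m) (j : Fin n) :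
    Differentiable ℝ fun z : DataIdx m n → ℝ => dataMat z i j :=
  differentiable_apply (𝕜 := ℝ) (Sum.inl (j, i) : DataIdx m n)

theorem differentiable_dataRhs_apply {m n : ℕ} (i : Fin m) :
    Differentiable ℝ fun z : DataIdx m n → ℝ => dataRhs z i :=
  differentiable_apply (𝕜 := ℝ) (Sum.inr i : DataIdx m n)

/-- Cramer's rule: the adjugate and the determinant of `M̃` are continuous, and the latter is
nonzero at `z`. -/
theorem continuousAt_tlsX {m n : ℕ} {z : DataIdx m n → ℝ} (hz : z ∈ tlsDomain m n) :
    ContinuousAt (fun z => tlsX (dataMat z) (dataRhs z)) z := by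
  have hA := continuous_dataMat m n
  have hb := continuous_dataRhs m n
  have hM : Continuous fun z : DataIdx m n → ℝ => tlsM (dataMat z) (dataRhs z) := by
    simp_rw [tlsM_eq]
    exact (hA.matrix_transpose.matrix_mul hA).sub
      (((continuous_sigmaTilde m n).pow 2).smul continuous_const)
  have hadj : ContinuousAt (fun z : DataIdx m n → ℝ =>
      (tlsM (dataMat z) (dataRhs z)).adjugate *ᵥ ((dataMat z)ᵀ *ᵥ dataRhs z)) z :=
    (hM.matrix_adjugate.matrix_mulVec (hA.matrix_transpose.matrix_mulVec hb)).continuousAt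
  have hdet : ContinuousAt (fun z : DataIdx m n → ℝ =>
      (tlsM (dataMat z) (dataRhs z)).det⁻¹) z :=
    hM.matrix_det.continuousAt.inv₀ (isUnit_det_tlsM hz).ne_zero
  refine (hdet.smul hadj).congr (Eventually.of_forall fun y => ?_)
  simp only [tlsX_eq, Matrix.inv_def, Ring.inverse_eq_inv', Matrix.smul_mulVec]
  rfl

/-! ### From continuity to differentiability, and the derivative. -/

/-- Continuity of `c` suffices because it multiplies a factor vanishing at `z`: replacing `c y` by
`c z` costs `O(‖y - z‖) · o(1)`. This upgrades exact increment formulas to differentiability. -/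
theorem differentiableAt_sub_mul {V : Type*} [NormedAddCommGroup V] [NormedSpace ℝ V]
    {g c : V → ℝ} {z : V} (hg : DifferentiableAt ℝ g z) (hc : ContinuousAt c z) :
    DifferentiableAt ℝ (fun y => (g y - g z) * c y) z := by
  refine HasFDerivAt.differentiableAt (f' := c z • fderiv ℝ g z) ?_
  rw [hasFDerivAt_iff_isLittleO]
  have h1 : (fun y => (g y - g z - fderiv ℝ g z (y - z)) * c z) =o[𝓝 z] fun y => y - z := by
    simpa [mul_comm] using hg.hasFDerivAt.isLittleO.const_mul_left (c z)
  have h2 : (fun y => (g y - g z) * (c y - c z)) =o[𝓝 z] fun y => ‖y - z‖ * (1 : ℝ) := by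
    refine Asymptotics.IsBigO.mul_isLittleO hg.hasFDerivAt.isBigO_sub.norm_right ?_
    rw [Asymptotics.isLittleO_one_iff]
    simpa using hc.sub_const (c z)
  simp only [mul_one] at h2
  refine (h1.add h2.of_norm_right).congr_left fun y => ?_
  simp
  ring

section

variable {m n : ℕ} {A A' : Matrix (Fin m) (Fin n) ℝ} {b b' : Fin m → ℝ}

theorem dotProduct_tlsX_self_add_one_pos : 0 < tlsX A b ⬝ᵥ tlsX A b + 1 := by
  have : 0 ≤ tlsX A b ⬝ᵥ tlsX A b := by simpa using dotProduct_star_self_nonneg (tlsX A b)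
  linarith

/-- Both rows of the eigenvector equation in one identity. The free vector `y` may come from another
data point. -/
theorem dotProduct_residual (hσ : sigmaTilde A b < sigmaMin A) (y : Fin n → ℝ) :
    (b - A *ᵥ y) ⬝ᵥ tlsR A b = sigmaTilde A b ^ 2 * (y ⬝ᵥ tlsX A b + 1) := by
  have h : (A *ᵥ y) ⬝ᵥ tlsR A b = y ⬝ᵥ Aᵀ *ᵥ tlsR A b := by
    rw [Matrix.dotProduct_mulVec, Matrix.vecMul_transpose]
  rw [sub_dotProduct, dotProduct_tlsR hσ, h, transpose_mulVec_tlsR hσ, dotProduct_neg,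
    dotProduct_smul, smul_eq_mul]
  ring

/-- The exact change of the squared smallest singular value. -/
theorem sq_sigmaTilde_sub_mul (hσ : sigmaTilde A b < sigmaMin A)
    (hσ' : sigmaTilde A' b' < sigmaMin A') :
    (sigmaTilde A' b' ^ 2 - sigmaTilde A b ^ 2) * (tlsX A b ⬝ᵥ tlsX A' b' + 1)
      = ((b' - A' *ᵥ tlsX A b) - (b - A *ᵥ tlsX A b)) ⬝ᵥ tlsR A' b'
        + tlsR A b ⬝ᵥ ((b' - b) - (A' - A) *ᵥ tlsX A' b') := by
  -- Each data point is tested against the solution of the other, so both sides carry the same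
  -- factor `xᵀx' + 1`.
  have h1 := dotProduct_residual hσ' (tlsX A b)
  have h2 := dotProduct_residual hσ (tlsX A' b')
  have h3 : (b' - b) - (A' - A) *ᵥ tlsX A' b' = tlsR A' b' - (b - A *ᵥ tlsX A' b') := by
    rw [tlsR, Matrix.sub_mulVec]
    abel
  rw [h3, sub_mul, ← h1, dotProduct_comm (tlsX A b), ← h2]
  change _ = (b' - A' *ᵥ tlsX A b - tlsR A b) ⬝ᵥ _ + _
  rw [sub_dotProduct (b' - A' *ᵥ tlsX A b), dotProduct_sub (tlsR A b),
    dotProduct_comm (tlsR A b) (b - A *ᵥ tlsX A' b')]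
  ring

/-- The exact change of the total least squares solution. -/
theorem tlsM_mulVec_tlsX_sub (hσ : sigmaTilde A b < sigmaMin A)
    (hσ' : sigmaTilde A' b' < sigmaMin A') :
    tlsM A b *ᵥ (tlsX A' b' - tlsX A b)
      = (A'ᵀ *ᵥ b' - Aᵀ *ᵥ b) - (tlsM A' b' - tlsM A b) *ᵥ tlsX A' b' := by
  rw [Matrix.mulVec_sub, Matrix.sub_mulVec, tlsM_mulVec_tlsX hσ, tlsM_mulVec_tlsX hσ']
  abel

end

section

variable {m n : ℕ} {z : DataIdx m n → ℝ} (hz : z ∈ tlsDomain m n)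
include hz

/-- The factor `xᵀx' + 1` tends to `1 + ‖x‖² > 0`, so the exact increment formula can be divided by
it near `z`. Every term is then a data increment times a coefficient continuous at `z`. -/
theorem differentiableAt_sq_sigmaTilde :
    DifferentiableAt ℝ (fun z => sigmaTilde (dataMat z) (dataRhs z) ^ 2) z := by
  have hX := continuousAt_tlsX hz
  have hXl : ∀ l, ContinuousAt (fun y => tlsX (dataMat y) (dataRhs y) l) z :=
    fun l => (continuous_apply l).continuousAt.comp hX
  set x := tlsX (dataMat z) (dataRhs z) with hx
  set r := tlsR (dataMat z) (dataRhs z) with hr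
  have hden : ContinuousAt (fun y => x ⬝ᵥ tlsX (dataMat y) (dataRhs y) + 1) z := by
    simp only [dotProduct]
    fun_prop
  have hden0 : x ⬝ᵥ tlsX (dataMat z) (dataRhs z) + 1 ≠ 0 := dotProduct_tlsX_self_add_one_pos.ne'
  have hR : ∀ i, ContinuousAt (fun y => tlsR (dataMat y) (dataRhs y) i) z := fun i => by
    have h1 := (differentiable_dataRhs_apply (n := n) i).continuous
    have h2 := fun j => (differentiable_dataMat_apply (n := n) i j).continuous
    simp only [tlsR, Pi.sub_apply, Matrix.mulVec, dotProduct]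
    fun_prop
  have hp : ∀ i, DifferentiableAt ℝ (fun y : DataIdx m n → ℝ =>
      dataRhs y i - (dataMat y *ᵥ x) i) z := fun i => by
    have h1 := differentiable_dataRhs_apply (n := n) i
    have h2 := fun j => differentiable_dataMat_apply (n := n) i j
    simp only [Matrix.mulVec, dotProduct]
    fun_prop
  have hexp : DifferentiableAt ℝ (fun y => sigmaTilde (dataMat z) (dataRhs z) ^ 2
      + (∑ i, ((dataRhs y i - (dataMat y *ᵥ x) i) - (dataRhs z i - (dataMat z *ᵥ x) i))
          * (tlsR (dataMat y) (dataRhs y) i / (x ⬝ᵥ tlsX (dataMat y) (dataRhs y) + 1))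
        + ∑ i, ((dataRhs y i - dataRhs z i)
            * (r i / (x ⬝ᵥ tlsX (dataMat y) (dataRhs y) + 1))
          - ∑ l, (dataMat y i l - dataMat z i l) * (r i * tlsX (dataMat y) (dataRhs y) l
            / (x ⬝ᵥ tlsX (dataMat y) (dataRhs y) + 1))))) z := by
    refine (DifferentiableAt.add (DifferentiableAt.fun_sum fun i _ => ?_)
      (DifferentiableAt.fun_sum fun i _ => DifferentiableAt.sub ?_
        (DifferentiableAt.fun_sum fun l _ => ?_))).const_add _
    · exact differentiableAt_sub_mul (hp i) ((hR i).div hden hden0)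
    · exact differentiableAt_sub_mul (differentiable_dataRhs_apply i z)
        (continuousAt_const.div hden hden0)
    · exact differentiableAt_sub_mul (differentiable_dataMat_apply i l z)
        ((continuousAt_const.mul (hXl l)).div hden hden0)
  refine hexp.congr_of_eventuallyEq ?_
  filter_upwards [(isOpen_tlsDomain m n).mem_nhds hz, hden.eventually_ne hden0] with y hy hne
  have h := sq_sigmaTilde_sub_mul hz hy
  have h' := eq_div_of_mul_eq hne h
  rw [← sub_eq_iff_eq_add', h', add_div]
  simp only [dotProduct, Pi.sub_apply, Matrix.sub_mulVec, Matrix.mulVec, Finset.sum_div]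
  congr 1
  · exact Finset.sum_congr rfl fun i _ => by rw [mul_div_assoc]
  · refine Finset.sum_congr rfl fun i _ => ?_
    rw [mul_div_assoc', mul_comm (dataRhs y i - dataRhs z i), mul_sub, sub_div,
      ← Finset.sum_sub_distrib, Finset.mul_sum, Finset.sum_div]
    congr 1
    exact Finset.sum_congr rfl fun l _ => by ring

/-- The same bootstrap: `M̃` is now differentiable, and in the exact increment of `x` its difference
is multiplied by the continuous `x'`. -/
theorem differentiableAt_tlsX :
    DifferentiableAt ℝ (fun z => tlsX (dataMat z) (dataRhs z)) z := by
  have hX := continuousAt_tlsX hz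
  have hXl : ∀ l, ContinuousAt (fun y => tlsX (dataMat y) (dataRhs y) l) z :=
    fun l => (continuous_apply l).continuousAt.comp hX
  have hs := differentiableAt_sq_sigmaTilde hz
  have hA := fun i j => differentiable_dataMat_apply (m := m) (n := n) i j
  have hb := fun i => differentiable_dataRhs_apply (m := m) (n := n) i
  have hM : ∀ i j, DifferentiableAt ℝ (fun y : DataIdx m n → ℝ =>
      tlsM (dataMat y) (dataRhs y) i j) z := fun i j => by
    simp only [tlsM_eq, Matrix.sub_apply, Matrix.mul_apply, Matrix.transpose_apply,
      Matrix.smul_apply, smul_eq_mul]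
    fun_prop
  have hrhs : DifferentiableAt ℝ (fun y : DataIdx m n → ℝ =>
      tlsX (dataMat z) (dataRhs z) + (tlsM (dataMat z) (dataRhs z))⁻¹.mulVecLin.toContinuousLinearMap
        (fun i => (((dataMat y)ᵀ *ᵥ dataRhs y) i - ((dataMat z)ᵀ *ᵥ dataRhs z) i)
          - ∑ j, (tlsM (dataMat y) (dataRhs y) i j - tlsM (dataMat z) (dataRhs z) i j)
            * tlsX (dataMat y) (dataRhs y) j)) z := by
    refine ((ContinuousLinearMap.differentiableAt _).comp z
      (differentiableAt_pi.2 fun i => DifferentiableAt.sub (DifferentiableAt.sub_const ?_ _)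
        (DifferentiableAt.fun_sum fun j _ => ?_))).const_add _
    · simp only [Matrix.mulVec, dotProduct, Matrix.transpose_apply]
      fun_prop
    · exact differentiableAt_sub_mul (hM i j) (hXl j)
  refine hrhs.congr_of_eventuallyEq ?_
  filter_upwards [(isOpen_tlsDomain m n).mem_nhds hz] with y hy
  rw [← sub_eq_iff_eq_add', ← Matrix.one_mulVec (tlsX _ _ - tlsX _ _),
    ← Matrix.nonsing_inv_mul _ (isUnit_det_tlsM hz), ← Matrix.mulVec_mulVec,
    tlsM_mulVec_tlsX_sub hz hy]
  rfl

/-- The derivative of the total least squares solution solves the linearized normal equations. -/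
theorem tlsM_mulVec_fderiv_tlsX (Δ : DataIdx m n → ℝ) :
    tlsM (dataMat z) (dataRhs z) *ᵥ fderiv ℝ (fun z => tlsX (dataMat z) (dataRhs z)) z Δ
      = (dataMat Δ)ᵀ *ᵥ tlsR (dataMat z) (dataRhs z)
        + ((dataMat z)ᵀ + (2 / (1 + tlsX (dataMat z) (dataRhs z) ⬝ᵥ tlsX (dataMat z) (dataRhs z))) •
            Matrix.vecMulVec (tlsX (dataMat z) (dataRhs z)) (tlsR (dataMat z) (dataRhs z))) *ᵥ
          (dataRhs Δ - dataMat Δ *ᵥ tlsX (dataMat z) (dataRhs z)) := by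
  have hXd := (differentiableAt_tlsX hz).hasFDerivAt.hasLineDerivAt Δ
  have hsd := (differentiableAt_sq_sigmaTilde hz).hasFDerivAt.hasLineDerivAt Δ
  set dx := fderiv ℝ (fun z => tlsX (dataMat z) (dataRhs z)) z Δ with hdx
  set ds := fderiv ℝ (fun z => sigmaTilde (dataMat z) (dataRhs z) ^ 2) z Δ with hds
  set dA := dataMat Δ with hdA
  set db := dataRhs Δ with hdb
  have hXl : ∀ l, HasDerivAt (fun t : ℝ => tlsX (dataMat (z + t • Δ)) (dataRhs (z + t • Δ)) l)
      (dx l) 0 := hasDerivAt_pi.1 hXd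
  have hs : HasDerivAt
      (fun t : ℝ => sigmaTilde (dataMat (z + t • Δ)) (dataRhs (z + t • Δ)) ^ 2) ds 0 := hsd
  have hlin : ∀ a c : ℝ, HasDerivAt (fun t : ℝ => a + t * c) c 0 := fun a c => by
    simpa using ((hasDerivAt_id (0 : ℝ)).mul_const c).const_add a
  have hA : ∀ i j, HasDerivAt (fun t : ℝ => dataMat (z + t • Δ) i j) (dA i j) 0 :=
    fun i j => hlin _ _
  have hb : ∀ i, HasDerivAt (fun t : ℝ => dataRhs (z + t • Δ) i) (db i) 0 := fun i => hlin _ _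
  have hz0 : z + (0 : ℝ) • Δ = z := by simp
  have hR : ∀ i, HasDerivAt (fun t : ℝ => tlsR (dataMat (z + t • Δ)) (dataRhs (z + t • Δ)) i)
      ((db - dA *ᵥ tlsX (dataMat z) (dataRhs z) - dataMat z *ᵥ dx) i) 0 := fun i => by
    have := (hb i).fun_sub (HasDerivAt.fun_sum (u := Finset.univ)
      fun l _ => (hA i l).fun_mul (hXl l))
    refine this.congr_deriv ?_
    simp only [hz0, Finset.sum_add_distrib, Pi.sub_apply, Matrix.mulVec, dotProduct]
    ring
  have hdom : ∀ᶠ t : ℝ in 𝓝 0, z + t • Δ ∈ tlsDomain m n := by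
    have hc : Tendsto (fun t : ℝ => z + t • Δ) (𝓝 0) (𝓝 (z + (0 : ℝ) • Δ)) :=
      Continuous.tendsto (by fun_prop) 0
    rw [hz0] at hc
    exact hc ((isOpen_tlsDomain m n).mem_nhds hz)
  set A := dataMat z with hAdef
  set b := dataRhs z with hbdef
  set x := tlsX A b with hx
  set r := tlsR A b with hr
  set e := db - dA *ᵥ x with he
  -- Differentiate `Aᵀr + σ̃² x = 0` along the line.
  have e1 : dAᵀ *ᵥ r + Aᵀ *ᵥ (e - A *ᵥ dx) + (ds • x + sigmaTilde A b ^ 2 • dx) = 0 := by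
    ext j
    have h1 := (HasDerivAt.fun_sum (u := Finset.univ)
      fun i _ => (hA i j).fun_mul (hR i)).fun_add (hs.fun_mul (hXl j))
    have h2 : (fun t : ℝ => (∑ i, dataMat (z + t • Δ) i j
        * tlsR (dataMat (z + t • Δ)) (dataRhs (z + t • Δ)) i)
        + sigmaTilde (dataMat (z + t • Δ)) (dataRhs (z + t • Δ)) ^ 2
          * tlsX (dataMat (z + t • Δ)) (dataRhs (z + t • Δ)) j) =ᶠ[𝓝 0] fun _ => (0 : ℝ) := by
      filter_upwards [hdom] with t ht
      have := congrFun (transpose_mulVec_tlsR ht) j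
      simp only [Matrix.mulVec, dotProduct, Matrix.transpose_apply, Pi.neg_apply, Pi.smul_apply,
        smul_eq_mul] at this
      rw [this]
      ring
    have h3 := (h1.congr_of_eventuallyEq h2.symm).unique (hasDerivAt_const (0 : ℝ) (0 : ℝ))
    simp only [hz0, Finset.sum_add_distrib] at h3
    exact h3
  -- Differentiate `dotProduct_residual` with `y` frozen at the base solution `x`.
  have e2 : e ⬝ᵥ r + r ⬝ᵥ (e - A *ᵥ dx)
      = ds * (x ⬝ᵥ x + 1) + sigmaTilde A b ^ 2 * (x ⬝ᵥ dx) := by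
    have hp : ∀ i, HasDerivAt (fun t : ℝ => dataRhs (z + t • Δ) i
        - ∑ l, dataMat (z + t • Δ) i l * x l) (e i) 0 := fun i =>
      (hb i).fun_sub (HasDerivAt.fun_sum fun l _ => (hA i l).mul_const (x l))
    have h1 := HasDerivAt.fun_sum (u := Finset.univ) fun i _ => (hp i).fun_mul (hR i)
    have h2 := hs.fun_mul ((HasDerivAt.fun_sum (u := Finset.univ)
      fun l _ => (hXl l).const_mul (x l)).add_const 1)
    have h3 : (fun t : ℝ => ∑ i, (dataRhs (z + t • Δ) i - ∑ l, dataMat (z + t • Δ) i l * x l)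
        * tlsR (dataMat (z + t • Δ)) (dataRhs (z + t • Δ)) i) =ᶠ[𝓝 0]
        fun t => sigmaTilde (dataMat (z + t • Δ)) (dataRhs (z + t • Δ)) ^ 2
          * (∑ l, x l * tlsX (dataMat (z + t • Δ)) (dataRhs (z + t • Δ)) l + 1) := by
      filter_upwards [hdom] with t ht
      exact dotProduct_residual ht x
    have h4 := h1.unique (h2.congr_of_eventuallyEq h3)
    simp only [hz0, Finset.sum_add_distrib] at h4
    exact h4
  have e3 : r ⬝ᵥ A *ᵥ dx = -(sigmaTilde A b ^ 2 * (x ⬝ᵥ dx)) := by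
    rw [Matrix.dotProduct_mulVec, ← Matrix.mulVec_transpose, transpose_mulVec_tlsR hz,
      neg_dotProduct, smul_dotProduct, smul_eq_mul]
  -- The terms containing `dx` cancel by `e3`; the two equal terms `r ⬝ᵥ e` produce the factor 2.
  have e4 : ds = 2 / (1 + x ⬝ᵥ x) * (r ⬝ᵥ e) := by
    have hpos : 0 < x ⬝ᵥ x + 1 := dotProduct_tlsX_self_add_one_pos
    rw [dotProduct_sub, e3, dotProduct_comm e] at e2
    rw [add_comm 1]
    field_simp
    linarith
  have e5 : Matrix.vecMulVec x r *ᵥ e = (r ⬝ᵥ e) • x := by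
    ext i
    simp only [Matrix.mulVec, dotProduct, Matrix.vecMulVec_apply, Pi.smul_apply, smul_eq_mul,
      Finset.sum_mul]
    exact Finset.sum_congr rfl fun _ _ => by ring
  rw [tlsM_mulVec, Matrix.add_mulVec, Matrix.smul_mulVec, e5, smul_smul, ← e4]
  rw [Matrix.mulVec_sub] at e1
  rw [← sub_eq_zero, ← neg_eq_zero, ← e1]
  abel

end

/-! ### The Kronecker form of the derivative. -/

theorem rowKron_mulVec_vec {m n : ℕ} {κ : Type*} (v : Fin n → ℝ) (C : Matrix κ (Fin m) ℝ)
    (X : Matrix (Fin m) (Fin n) ℝ) : rowKron v C *ᵥ Matrix.vec X = C *ᵥ (X *ᵥ v) := by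
  ext i
  simp only [Matrix.mulVec, dotProduct, rowKron, Matrix.submatrix_apply, Matrix.kroneckerMap_apply,
    Matrix.replicateRow_apply, Fintype.sum_prod_type, Matrix.vec, id, Finset.mul_sum]
  rw [Finset.sum_comm]
  exact Finset.sum_congr rfl fun _ _ => Finset.sum_congr rfl fun _ _ => by ring

theorem tlsMatrix_mulVec {m n k : ℕ} (A : Matrix (Fin m) (Fin n) ℝ) (b : Fin m → ℝ)
    (L : Matrix (Fin n) (Fin k) ℝ) (Δ : DataIdx m n → ℝ) :
    tlsMatrix A b L *ᵥ Δ = Lᵀ *ᵥ ((tlsM A b)⁻¹ *ᵥ ((dataMat Δ)ᵀ *ᵥ tlsR A b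
      + (Aᵀ + (2 / (1 + tlsX A b ⬝ᵥ tlsX A b)) • Matrix.vecMulVec (tlsX A b) (tlsR A b)) *ᵥ
        (dataRhs Δ - dataMat Δ *ᵥ tlsX A b))) := by
  have h : Δ = Sum.elim (Matrix.vec (dataMat Δ)) (dataRhs Δ) := by
    ext (⟨j, i⟩ | i) <;> rfl
  conv_lhs => rw [h]
  rw [tlsMatrix, Matrix.fromCols_mulVec_sumElim, tlsN, Matrix.sub_mulVec, ← Matrix.mulVec_mulVec,
    vecPermMatrix_mulVec_vec, rowKron_mulVec_vec, rowKron_mulVec_vec, tlsD]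
  simp only [← Matrix.mulVec_mulVec, Matrix.mulVec_sub, Matrix.mulVec_add]
  abel

theorem hasFDerivAt_tlsMap {m n k : ℕ} (L : Matrix (Fin n) (Fin k) ℝ) {z : DataIdx m n → ℝ}
    (hz : z ∈ tlsDomain m n) :
    HasFDerivAt (tlsMap L)
      (tlsMatrix (dataMat z) (dataRhs z) L).mulVecLin.toContinuousLinearMap z := by
  have h := (Lᵀ.mulVecLin.toContinuousLinearMap.hasFDerivAt
    (x := tlsX (dataMat z) (dataRhs z))).comp z (differentiableAt_tlsX hz).hasFDerivAt
  refine h.congr_fderiv (ContinuousLinearMap.ext fun Δ => ?_)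
  change Lᵀ *ᵥ _ = tlsMatrix (dataMat z) (dataRhs z) L *ᵥ Δ
  rw [tlsMatrix_mulVec, ← tlsM_mulVec_fderiv_tlsX hz]
  congr 1
  rw [Matrix.mulVec_mulVec, Matrix.nonsing_inv_mul _ (isUnit_det_tlsM hz), Matrix.one_mulVec]
  rfl

theorem dataMat_dataVec {m n : ℕ} (A : Matrix (Fin m) (Fin n) ℝ) (b : Fin m → ℝ) :
    dataMat (dataVec A b) = A := rfl

theorem dataRhs_dataVec {m n : ℕ} (A : Matrix (Fin m) (Fin n) ℝ) (b : Fin m → ℝ) :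
    dataRhs (dataVec A b) = b := rfl

theorem IsLeast.of_mem_iff {α : Type*} [Preorder α] {s t : Set α} {a : α} (h : IsLeast s a)
    (hst : ∀ c, c ∈ t ↔ c ∈ s) : IsLeast t a :=
  (Set.ext hst : t = s) ▸ h

/-- All the analysis ends here: each condition number is now a least constant for the explicit
matrix `tlsMatrix A b L`. -/
theorem isCondNumber_tlsMap {m n k : ℕ} {A : Matrix (Fin m) (Fin n) ℝ} {b : Fin m → ℝ}
    (L : Matrix (Fin n) (Fin k) ℝ) (hσ : sigmaTilde A b < sigmaMin A)
    {S : Set (DataIdx m n → ℝ)} {μ : Seminorm ℝ (DataIdx m n → ℝ)} {ν : Seminorm ℝ (Fin k → ℝ)}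
    {β : DataIdx m n → ℝ} {ξ : Fin k → ℝ} (hμ : IsVecNorm μ)
    (hS : ∀ t : ℝ, ∀ Δ ∈ S, t • Δ ∈ S) {c : ℝ}
    (hc : IsLeast {c : ℝ | 0 ≤ c ∧ ∀ Δ ∈ admissible S β,
      ν (entryDiv (tlsMatrix A b L *ᵥ Δ) ξ) ≤ c * μ (entryDiv Δ β)} c) :
    IsCondNumber (tlsMap L) (tlsDomain m n) S μ ν β ξ (dataVec A b) c := by
  have hz : dataVec A b ∈ tlsDomain m n := by
    rwa [tlsDomain, Set.mem_ofPred_eq, dataMat_dataVec, dataRhs_dataVec]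
  have hF := hasFDerivAt_tlsMap L hz
  rw [dataMat_dataVec, dataRhs_dataVec] at hF
  exact isCondNumber_of_isLeast hμ (isOpen_tlsDomain m n) hz hS hF hc

/-! ### Least constants for unstructured perturbations. -/

theorem isVecNorm_norm2 (ι : Type*) [Fintype ι] : IsVecNorm (norm2 ι) := fun y hy => by
  have h : WithLp.toLp 2 y = (0 : EuclideanSpace ℝ ι) := norm_eq_zero.1 hy
  ext i
  exact congrFun (congrArg WithLp.ofLp h) i

theorem isVecNorm_normInf (ι : Type*) [Fintype ι] : IsVecNorm (normInf ι) :=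
  fun _ hy => norm_eq_zero.1 hy

theorem norm2_sq {ι : Type*} [Fintype ι] (y : ι → ℝ) : norm2 ι y ^ 2 = y ⬝ᵥ y :=
  sq_norm_toLp_two y

section

variable {ι κ : Type*} [Fintype ι] [DecidableEq ι] [Fintype κ] [DecidableEq κ]

theorem diagDdag_mul_mul_diagonal_mulVec (T : Matrix κ ι ℝ) (β y : ι → ℝ) (ξ : κ → ℝ) :
    (diagDdag ξ * T * Matrix.diagonal β) *ᵥ y = entryDiv (T *ᵥ (β * y)) ξ := by
  rw [← Matrix.mulVec_mulVec, ← Matrix.mulVec_mulVec]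
  ext i
  rw [diagDdag, Matrix.mulVec_diagonal, entryDiv]
  congr 3
  ext j
  rw [Matrix.mulVec_diagonal, Pi.mul_apply]

/-- Admissible perturbations and parameter vectors give the same bounds. -/
theorem setOf_bound_admissible_univ {μ : Seminorm ℝ (ι → ℝ)} (ν : Seminorm ℝ (κ → ℝ))
    (T : Matrix κ ι ℝ) {β : ι → ℝ} (ξ : κ → ℝ)
    (hβ : ∀ y, μ (fun i => if β i = 0 then 0 else y i) ≤ μ y) :
    {c : ℝ | 0 ≤ c ∧ ∀ Δ ∈ admissible Set.univ β,
        ν (entryDiv (T *ᵥ Δ) ξ) ≤ c * μ (entryDiv Δ β)}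
      = {c : ℝ | 0 ≤ c ∧
        ∀ y, ν ((diagDdag ξ * T * Matrix.diagonal β) *ᵥ y) ≤ c * μ y} := by
  ext c
  refine and_congr_right fun hc => ⟨fun h y => ?_, fun h Δ hΔ => ?_⟩
  · rw [diagDdag_mul_mul_diagonal_mulVec]
    refine (h (β * y) ⟨trivial, fun i hi => by simp [hi]⟩).trans
      (mul_le_mul_of_nonneg_left ?_ hc)
    -- Multiplying and then dividing by `β` erases the coordinates where `β` is zero; `hβ` says this
    -- does not increase `μ`.
    have hy : entryDiv (β * y) β = fun i => if β i = 0 then 0 else y i := by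
      funext i
      by_cases hi : β i = 0
      · simp [entryDiv, hi]
      · simp [entryDiv, ddag_of_ne_zero hi, hi]
    rw [hy]
    exact hβ y
  · have h1 := h (entryDiv Δ β)
    have hy : β * entryDiv Δ β = Δ := by
      funext i
      by_cases hi : β i = 0
      · simp [hΔ.2 i hi, hi]
      · simp [entryDiv, ddag_of_ne_zero hi, hi]
    rwa [diagDdag_mul_mul_diagonal_mulVec, hy] at h1

theorem isLeast_admissible_univ {μ : Seminorm ℝ (ι → ℝ)} (hμ : IsVecNorm μ)
    (ν : Seminorm ℝ (κ → ℝ)) (T : Matrix κ ι ℝ) {β : ι → ℝ} (ξ : κ → ℝ)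
    (hβ : ∀ y, μ (fun i => if β i = 0 then 0 else y i) ≤ μ y) :
    IsLeast {c : ℝ | 0 ≤ c ∧ ∀ Δ ∈ admissible Set.univ β,
        ν (entryDiv (T *ᵥ Δ) ξ) ≤ c * μ (entryDiv Δ β)}
      (inducedNorm μ ν (diagDdag ξ * T * Matrix.diagonal β)) := by
  rw [setOf_bound_admissible_univ ν T ξ hβ]
  exact isLeast_inducedNorm hμ ν _

omit [DecidableEq ι] [DecidableEq κ] in
/-- The matrix norm induced by the maximum norms is the largest absolute row sum. -/
theorem isLeast_normInf_mulVec (K : Matrix κ ι ℝ) :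
    IsLeast {c : ℝ | 0 ≤ c ∧ ∀ y, normInf κ (K *ᵥ y) ≤ c * normInf ι y}
      ‖absMat K *ᵥ 1‖ := by
  refine ⟨⟨norm_nonneg _, fun y => ?_⟩, fun c ⟨hc, h⟩ => ?_⟩
  · refine (pi_norm_le_iff_of_nonneg (by positivity)).2 fun i => ?_
    calc ‖(K *ᵥ y) i‖ ≤ ∑ j, ‖K i j * y j‖ := norm_sum_le _ _
      _ ≤ ∑ j, absMat K i j * (1 : ι → ℝ) j * ‖y‖ := Finset.sum_le_sum fun j _ => by
          rw [norm_mul, Pi.one_apply, mul_one]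
          exact mul_le_mul_of_nonneg_left (norm_le_pi_norm y j) (abs_nonneg _)
      _ = (absMat K *ᵥ 1) i * ‖y‖ := by rw [← Finset.sum_mul]; rfl
      _ ≤ ‖absMat K *ᵥ 1‖ * ‖y‖ := mul_le_mul_of_nonneg_right
          ((Real.le_norm_self _).trans (norm_le_pi_norm (absMat K *ᵥ 1) i)) (norm_nonneg _)
  · refine (pi_norm_le_iff_of_nonneg hc).2 fun i => ?_
    -- The sign pattern of row `i` turns its entry of `K *ᵥ y` into the absolute row sum.
    let y : ι → ℝ := fun j => SignType.sign (K i j)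
    have hy : ‖y‖ ≤ 1 := (pi_norm_le_iff_of_nonneg zero_le_one).2 fun j => by
      rcases lt_trichotomy (K i j) 0 with h | h | h <;> simp [y, h]
    have h1 : (K *ᵥ y) i = (absMat K *ᵥ 1) i := by
      refine Finset.sum_congr rfl fun j _ => ?_
      simp [y, absMat]
    rw [← h1]
    calc ‖(K *ᵥ y) i‖ ≤ ‖K *ᵥ y‖ := norm_le_pi_norm _ i
      _ ≤ c * ‖y‖ := h y
      _ ≤ c := mul_le_of_le_one_right hc hy

theorem absMat_diagDdag_mul_mul_diagonal (T : Matrix κ ι ℝ) (z : ι → ℝ) (ξ : κ → ℝ) :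
    absMat (diagDdag ξ * T * Matrix.diagonal z) *ᵥ 1
      = entryDiv (absMat T *ᵥ absVec z) (absVec ξ) := by
  ext i
  simp only [Matrix.mulVec, dotProduct, absMat, Matrix.map_apply, diagDdag, Matrix.mul_diagonal,
    Matrix.diagonal_mul, abs_mul, entryDiv, absVec, ddag_abs, Finset.mul_sum, Pi.one_apply, mul_one,
    mul_assoc]

omit [DecidableEq ι] in
theorem normInf_ite_le (β y : ι → ℝ) :
    normInf ι (fun i => if β i = 0 then 0 else y i) ≤ normInf ι y := by
  refine (pi_norm_le_iff_of_nonneg (norm_nonneg y)).2 fun i => ?_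
  by_cases hi : β i = 0
  · simp [hi]
  · simpa [hi] using norm_le_pi_norm y i

theorem isLeast_normInf_admissible_univ (T : Matrix κ ι ℝ) (z : ι → ℝ) (ξ : κ → ℝ) :
    IsLeast {c : ℝ | 0 ≤ c ∧ ∀ Δ ∈ admissible Set.univ z,
        normInf κ (entryDiv (T *ᵥ Δ) ξ) ≤ c * normInf ι (entryDiv Δ z)}
      ‖entryDiv (absMat T *ᵥ absVec z) (absVec ξ)‖ := by
  rw [setOf_bound_admissible_univ _ T ξ (normInf_ite_le z), ← absMat_diagDdag_mul_mul_diagonal]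
  exact isLeast_normInf_mulVec _

omit [Fintype ι] [DecidableEq ι] [DecidableEq κ] in
theorem norm_entryDiv_absVec_const (v : κ → ℝ) {t : ℝ} (ht : 0 ≤ t) :
    ‖entryDiv v (absVec fun _ => t)‖ = ddag t * ‖v‖ := by
  have h : entryDiv v (absVec fun _ => t) = ddag t • v := by
    ext i
    simp [entryDiv, absVec, abs_of_nonneg ht]
  rw [h, norm_smul, Real.norm_of_nonneg (ddag_nonneg ht)]

/-! ### Least constants for structured perturbations. -/

omit [DecidableEq ι] [Fintype κ] [DecidableEq κ] in
theorem mulVec_apply_of_rowsAtMostOne {Φ : Matrix κ ι ℝ} (hΦ : RowsAtMostOne Φ) {i : κ} {l : ι}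
    (h : Φ i l ≠ 0) (s : ι → ℝ) : (Φ *ᵥ s) i = Φ i l * s l := by
  refine Finset.sum_eq_single l (fun l' _ hne => ?_) fun h => absurd (Finset.mem_univ l) h
  have : Φ i l' = 0 := by
    by_contra h'
    exact hne (hΦ i l' l h' h)
  change Φ i l' * s l' = 0
  rw [this, zero_mul]

-- Every parameter is seen by some row, as columns are nonzero, and a row sees at most one
-- parameter. So the zero patterns of data and parameters determine the same constraint.
omit [DecidableEq ι] [Fintype κ] [DecidableEq κ] in
theorem mem_admissible_range_iff {Φ : Matrix κ ι ℝ} (hΦ : RowsAtMostOne Φ)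
    (hcol : ∀ l, Φ.col l ≠ 0) {S : Set (κ → ℝ)} (hS : ∀ Δ, Δ ∈ S ↔ ∃ s, Δ = Φ *ᵥ s)
    (s₀ s : ι → ℝ) : Φ *ᵥ s ∈ admissible S (Φ *ᵥ s₀) ↔ s ∈ admissible Set.univ s₀ := by
  constructor
  · refine fun h => ⟨trivial, fun l hl => ?_⟩
    obtain ⟨i, hi⟩ := Function.ne_iff.1 (hcol l)
    have hi' : Φ i l ≠ 0 := hi
    have h1 := h.2 i (by rw [mulVec_apply_of_rowsAtMostOne hΦ hi', hl, mul_zero])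
    rw [mulVec_apply_of_rowsAtMostOne hΦ hi'] at h1
    exact (mul_eq_zero.1 h1).resolve_left hi'
  · refine fun h => ⟨(hS _).2 ⟨s, rfl⟩, fun i hi => ?_⟩
    refine Finset.sum_eq_zero fun l _ => ?_
    change Φ i l * s l = 0
    by_cases hl : Φ i l = 0
    · rw [hl, zero_mul]
    · rw [mulVec_apply_of_rowsAtMostOne hΦ hl] at hi
      rw [h.2 l ((mul_eq_zero.1 hi).resolve_left hl), mul_zero]

-- The coefficient `Φ i l` cancels in the quotient, so both vectors have the same entries up to
-- repetition and zeros.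
omit [DecidableEq ι] [DecidableEq κ] in
theorem normInf_entryDiv_mulVec {Φ : Matrix κ ι ℝ} (hΦ : RowsAtMostOne Φ)
    (hcol : ∀ l, Φ.col l ≠ 0) {s₀ s : ι → ℝ} (hs : s ∈ admissible Set.univ s₀) :
    normInf κ (entryDiv (Φ *ᵥ s) (Φ *ᵥ s₀)) = normInf ι (entryDiv s s₀) := by
  have key : ∀ i l, Φ i l ≠ 0 → entryDiv (Φ *ᵥ s) (Φ *ᵥ s₀) i = entryDiv s s₀ l := fun i l h => by
    simp only [entryDiv, mulVec_apply_of_rowsAtMostOne hΦ h]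
    by_cases hl : s₀ l = 0
    · simp [hs.2 l hl]
    · rw [ddag_of_ne_zero hl, ddag_of_ne_zero (mul_ne_zero h hl)]
      field_simp
  refine le_antisymm ?_ ?_
  · refine (pi_norm_le_iff_of_nonneg (norm_nonneg (entryDiv s s₀))).2 fun i => ?_
    by_cases h : ∃ l, Φ i l ≠ 0
    · obtain ⟨l, hl⟩ := h
      rw [key i l hl]
      exact norm_le_pi_norm (entryDiv s s₀) l
    · have h0 : (Φ *ᵥ s) i = 0 := Finset.sum_eq_zero fun l _ => by
        change Φ i l * s l = 0
        rw [not_not.1 (not_exists.1 h l), zero_mul]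
      rw [entryDiv, h0, mul_zero, norm_zero]
      exact norm_nonneg _
  · refine (pi_norm_le_iff_of_nonneg (norm_nonneg (entryDiv (Φ *ᵥ s) (Φ *ᵥ s₀)))).2 fun l => ?_
    obtain ⟨i, hi⟩ := Function.ne_iff.1 (hcol l)
    rw [← key i l hi]
    exact norm_le_pi_norm (entryDiv (Φ *ᵥ s) (Φ *ᵥ s₀)) i

omit [DecidableEq ι] in
/-- Structured perturbations, for the maximum norm, reduce to perturbations of the independent
parameters. -/
theorem isLeast_normInf_structured {p : Type*} [Fintype p] [DecidableEq p] (T : Matrix κ ι ℝ)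
    {Φ : Matrix ι p ℝ} (hΦ : RowsAtMostOne Φ) (hcol : ∀ l, Φ.col l ≠ 0) {S : Set (ι → ℝ)}
    (hS : ∀ Δ, Δ ∈ S ↔ ∃ s, Δ = Φ *ᵥ s) (s₀ : p → ℝ) (ξ : κ → ℝ) :
    IsLeast {c : ℝ | 0 ≤ c ∧ ∀ Δ ∈ admissible S (Φ *ᵥ s₀),
        normInf κ (entryDiv (T *ᵥ Δ) ξ) ≤ c * normInf ι (entryDiv Δ (Φ *ᵥ s₀))}
      ‖entryDiv (absMat (T * Φ) *ᵥ absVec s₀) (absVec ξ)‖ := by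
  refine (isLeast_normInf_admissible_univ (T * Φ) s₀ ξ).of_mem_iff fun c => ?_
  refine and_congr_right fun _ => ⟨fun h s hs => ?_, fun h Δ hΔ => ?_⟩
  · rw [← Matrix.mulVec_mulVec, ← normInf_entryDiv_mulVec hΦ hcol hs]
    exact h _ ((mem_admissible_range_iff hΦ hcol hS s₀ s).2 hs)
  · obtain ⟨s, rfl⟩ := (hS Δ).1 hΔ.1
    have hs := (mem_admissible_range_iff hΦ hcol hS s₀ s).1 hΔ
    rw [Matrix.mulVec_mulVec, normInf_entryDiv_mulVec hΦ hcol hs]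
    exact h s hs

omit [DecidableEq ι] [Fintype κ] [DecidableEq κ] in
theorem isLeast_inducedNorm_div {μ : Seminorm ℝ (ι → ℝ)} (hμ : IsVecNorm μ)
    (ν : Seminorm ℝ (κ → ℝ)) (N : Matrix κ ι ℝ) {ξ : ℝ} (hξ : 0 < ξ) :
    IsLeast {c : ℝ | 0 ≤ c ∧ ∀ y, ν (entryDiv (N *ᵥ y) fun _ => ξ) ≤ c * μ y}
      (inducedNorm μ ν N / ξ) := by
  have h := isLeast_inducedNorm hμ ν N
  have hν : ∀ v, ν (entryDiv v fun _ => ξ) = ν v / ξ := fun v => by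
    have : (entryDiv v fun _ => ξ) = ξ⁻¹ • v := by
      ext i
      simp [entryDiv, ddag_of_ne_zero hξ.ne']
    rw [this, map_smul_eq_mul, norm_inv, Real.norm_of_nonneg hξ.le, inv_mul_eq_div]
  simp only [hν]
  refine ⟨⟨div_nonneg h.1.1 hξ.le, fun y => ?_⟩, fun c ⟨hc, hc'⟩ => ?_⟩
  · rw [div_mul_eq_mul_div, div_le_div_iff_of_pos_right hξ]
    exact h.1.2 y
  · rw [div_le_iff₀ hξ]
    refine h.2 ⟨mul_nonneg hc hξ.le, fun y => ?_⟩
    have := hc' y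
    rw [div_le_iff₀ hξ] at this
    linarith

omit [DecidableEq κ] in
theorem mulVec_dotProduct_mulVec_of_columnOrthogonal {Φ : Matrix κ ι ℝ}
    (hΦ : ColumnOrthogonal Φ) (s : ι → ℝ) :
    (Φ *ᵥ s) ⬝ᵥ (Φ *ᵥ s) = (colNormDiag Φ *ᵥ s) ⬝ᵥ (colNormDiag Φ *ᵥ s) := by
  have h : Φᵀ * Φ = Matrix.diagonal fun l => norm2 κ (Φ.col l) ^ 2 := by
    ext l l'
    by_cases hl : l = l'
    · subst hl
      rw [Matrix.diagonal_apply_eq, norm2_sq]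
      rfl
    · rw [Matrix.diagonal_apply_ne _ hl]
      exact hΦ.2 l l' hl
  rw [← Matrix.vecMul_transpose Φ s, ← Matrix.dotProduct_mulVec, Matrix.vecMul_transpose,
    Matrix.mulVec_mulVec, h]
  refine Finset.sum_congr rfl fun l _ => ?_
  rw [colNormDiag, Matrix.mulVec_diagonal, Matrix.mulVec_diagonal]
  ring

omit [DecidableEq κ] in
theorem isUnit_det_colNormDiag {Φ : Matrix κ ι ℝ} (hΦ : ColumnOrthogonal Φ) :
    IsUnit (colNormDiag Φ).det := by
  rw [colNormDiag, Matrix.det_diagonal]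
  exact (Finset.prod_ne_zero_iff.2 fun l _ h => hΦ.1 l (isVecNorm_norm2 κ _ h)).isUnit

end

/-- Structured perturbations, for the Euclidean norm, in orthonormal coordinates. -/
theorem isLeast_norm2_structured {ι₁ ι₂ κ p₁ p₂ : Type*} [Fintype ι₁] [Fintype ι₂] [Fintype κ]
    [Fintype p₁] [Fintype p₂] [DecidableEq p₁] [DecidableEq p₂] (T₁ : Matrix κ ι₁ ℝ)
    (T₂ : Matrix κ ι₂ ℝ) {Φ₁ : Matrix ι₁ p₁ ℝ} {Φ₂ : Matrix ι₂ p₂ ℝ}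
    (h₁ : ColumnOrthogonal Φ₁) (h₂ : ColumnOrthogonal Φ₂) {S : Set (ι₁ ⊕ ι₂ → ℝ)}
    (hS : ∀ Δ, Δ ∈ S ↔ ∃ s₁ s₂, Δ = Sum.elim (Φ₁ *ᵥ s₁) (Φ₂ *ᵥ s₂)) {ψ β ξ : ℝ}
    (hψ : 0 < ψ) (hβ : 0 < β) (hξ : 0 < ξ) :
    IsLeast {c : ℝ | 0 ≤ c ∧ ∀ Δ ∈ admissible S (Sum.elim (fun _ => ψ) fun _ => β),
        norm2 κ (entryDiv (Matrix.fromCols T₁ T₂ *ᵥ Δ) fun _ => ξ)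
          ≤ c * norm2 (ι₁ ⊕ ι₂) (entryDiv Δ (Sum.elim (fun _ => ψ) fun _ => β))}
      (spectralNorm2 (Matrix.fromCols (ψ • (T₁ * Φ₁ * (colNormDiag Φ₁)⁻¹))
        (β • (T₂ * Φ₂ * (colNormDiag Φ₂)⁻¹))) / ξ) := by
  have hu₁ := isUnit_det_colNormDiag h₁
  have hu₂ := isUnit_det_colNormDiag h₂
  have hvec : ∀ (y₁ : p₁ → ℝ) (y₂ : p₂ → ℝ),
      Matrix.fromCols (ψ • (T₁ * Φ₁ * (colNormDiag Φ₁)⁻¹)) (β • (T₂ * Φ₂ * (colNormDiag Φ₂)⁻¹)) *ᵥ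
        Sum.elim y₁ y₂
      = Matrix.fromCols T₁ T₂ *ᵥ Sum.elim (Φ₁ *ᵥ (ψ • (colNormDiag Φ₁)⁻¹ *ᵥ y₁))
          (Φ₂ *ᵥ (β • (colNormDiag Φ₂)⁻¹ *ᵥ y₂)) := fun y₁ y₂ => by
    simp only [Matrix.fromCols_mulVec_sumElim, Matrix.smul_mulVec, Matrix.mulVec_smul,
      Matrix.mulVec_mulVec, Matrix.mul_assoc]
  -- The columns of `Φᵢ Dᵢ⁻¹` are orthonormal and the weights `ψ`, `β` cancel, so this
  -- parametrisation is isometric for the scaled norm.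
  have hnorm : ∀ (y₁ : p₁ → ℝ) (y₂ : p₂ → ℝ),
      norm2 _ (entryDiv (Sum.elim (Φ₁ *ᵥ (ψ • (colNormDiag Φ₁)⁻¹ *ᵥ y₁))
        (Φ₂ *ᵥ (β • (colNormDiag Φ₂)⁻¹ *ᵥ y₂))) (Sum.elim (fun _ => ψ) fun _ => β))
      = norm2 _ (Sum.elim y₁ y₂) := fun y₁ y₂ => by
    rw [← sq_eq_sq₀ (apply_nonneg _ _) (apply_nonneg _ _), norm2_sq, norm2_sq]
    have hd : entryDiv (Sum.elim (Φ₁ *ᵥ (ψ • (colNormDiag Φ₁)⁻¹ *ᵥ y₁))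
        (Φ₂ *ᵥ (β • (colNormDiag Φ₂)⁻¹ *ᵥ y₂))) (Sum.elim (fun _ => ψ) fun _ => β)
        = Sum.elim (Φ₁ *ᵥ ((colNormDiag Φ₁)⁻¹ *ᵥ y₁)) (Φ₂ *ᵥ ((colNormDiag Φ₂)⁻¹ *ᵥ y₂)) := by
      rw [Matrix.mulVec_smul, Matrix.mulVec_smul]
      ext (i | i)
      · simp [entryDiv, ddag_of_ne_zero hψ.ne', hψ.ne']
      · simp [entryDiv, ddag_of_ne_zero hβ.ne', hβ.ne']
    rw [hd, sumElim_dotProduct_sumElim, sumElim_dotProduct_sumElim,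
      mulVec_dotProduct_mulVec_of_columnOrthogonal h₁,
      mulVec_dotProduct_mulVec_of_columnOrthogonal h₂, Matrix.mulVec_mulVec, Matrix.mulVec_mulVec,
      Matrix.mul_nonsing_inv _ hu₁, Matrix.mul_nonsing_inv _ hu₂, Matrix.one_mulVec,
      Matrix.one_mulVec]
  refine (isLeast_inducedNorm_div (isVecNorm_norm2 (p₁ ⊕ p₂)) (norm2 κ) _ hξ).of_mem_iff
    fun c => ?_
  refine and_congr_right fun _ => ⟨fun h y => ?_, fun h Δ hΔ => ?_⟩
  · rw [← Sum.elim_comp_inl_inr y, hvec, ← hnorm]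
    refine h _ ⟨(hS _).2 ⟨_, _, rfl⟩, ?_⟩
    rintro (i | i) hi
    · exact absurd hi hψ.ne'
    · exact absurd hi hβ.ne'
  · obtain ⟨s₁, s₂, rfl⟩ := (hS Δ).1 hΔ.1
    have e₁ : s₁ = ψ • (colNormDiag Φ₁)⁻¹ *ᵥ (ψ⁻¹ • colNormDiag Φ₁ *ᵥ s₁) := by
      rw [Matrix.mulVec_smul, Matrix.mulVec_mulVec, Matrix.nonsing_inv_mul _ hu₁,
        Matrix.one_mulVec, smul_inv_smul₀ hψ.ne']
    have e₂ : s₂ = β • (colNormDiag Φ₂)⁻¹ *ᵥ (β⁻¹ • colNormDiag Φ₂ *ᵥ s₂) := by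
      rw [Matrix.mulVec_smul, Matrix.mulVec_mulVec, Matrix.nonsing_inv_mul _ hu₂,
        Matrix.one_mulVec, smul_inv_smul₀ hβ.ne']
    rw [e₁, e₂, hnorm, ← hvec]
    exact h _

/-! ### Assembling the condition numbers. -/

section

variable {m n k₁ k₂ : ℕ} {S₁ : Submodule ℝ (Matrix (Fin m) (Fin n) ℝ)}
  {S₂ : Submodule ℝ (Fin m → ℝ)} {Φ₁ : Matrix (Fin n × Fin m) (Fin k₁) ℝ}
  {Φ₂ : Matrix (Fin m) (Fin k₂) ℝ}

theorem smul_mem_structuredSet (t : ℝ) (Δ : DataIdx m n → ℝ) (hΔ : Δ ∈ structuredSet S₁ S₂) :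
    t • Δ ∈ structuredSet S₁ S₂ :=
  ⟨S₁.smul_mem t hΔ.1, S₂.smul_mem t hΔ.2⟩

theorem mem_structuredSet_iff (h₁ : ∀ C, C ∈ S₁ ↔ ∃ s, Matrix.vec C = Φ₁ *ᵥ s)
    (h₂ : ∀ c, c ∈ S₂ ↔ ∃ s, c = Φ₂ *ᵥ s) (Δ : DataIdx m n → ℝ) :
    Δ ∈ structuredSet S₁ S₂ ↔ ∃ s₁ s₂, Δ = Sum.elim (Φ₁ *ᵥ s₁) (Φ₂ *ᵥ s₂) := by
  constructor
  · rintro ⟨hA, hb⟩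
    obtain ⟨s₁, hs₁⟩ := (h₁ _).1 hA
    obtain ⟨s₂, hs₂⟩ := (h₂ _).1 hb
    refine ⟨s₁, s₂, ?_⟩
    rw [← hs₁, ← hs₂]
    ext (⟨j, i⟩ | i) <;> rfl
  · rintro ⟨s₁, s₂, rfl⟩
    exact ⟨(h₁ _).2 ⟨s₁, rfl⟩, (h₂ _).2 ⟨s₂, rfl⟩⟩

theorem fromBlocks_diag_mulVec_sumElim {ι₁ ι₂ p₁ p₂ : Type*} [Fintype p₁] [Fintype p₂]
    (Φ₁ : Matrix ι₁ p₁ ℝ) (Φ₂ : Matrix ι₂ p₂ ℝ) (s₁ : p₁ → ℝ) (s₂ : p₂ → ℝ) :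
    Matrix.fromBlocks Φ₁ 0 0 Φ₂ *ᵥ Sum.elim s₁ s₂ = Sum.elim (Φ₁ *ᵥ s₁) (Φ₂ *ᵥ s₂) := by
  simp [Matrix.fromBlocks_mulVec]

theorem rowsAtMostOne_fromBlocks_diag {ι₁ ι₂ p₁ p₂ : Type*} {Φ₁ : Matrix ι₁ p₁ ℝ}
    {Φ₂ : Matrix ι₂ p₂ ℝ} (h₁ : RowsAtMostOne Φ₁) (h₂ : RowsAtMostOne Φ₂) :
    RowsAtMostOne (Matrix.fromBlocks Φ₁ 0 0 Φ₂) := by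
  rintro (i | i) (l | l) (l' | l') hl hl'
  · exact congrArg _ (h₁ i l l' hl hl')
  · exact absurd rfl hl'
  · exact absurd rfl hl
  · exact absurd rfl hl
  · exact absurd rfl hl
  · exact absurd rfl hl
  · exact absurd rfl hl'
  · exact congrArg _ (h₂ i l l' hl hl')

theorem col_fromBlocks_diag_ne_zero {ι₁ ι₂ p₁ p₂ : Type*} {Φ₁ : Matrix ι₁ p₁ ℝ}
    {Φ₂ : Matrix ι₂ p₂ ℝ} (h₁ : ∀ l, Φ₁.col l ≠ 0) (h₂ : ∀ l, Φ₂.col l ≠ 0) (l : p₁ ⊕ p₂) :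
    (Matrix.fromBlocks Φ₁ 0 0 Φ₂).col l ≠ 0 := by
  rcases l with l | l
  · exact fun h => h₁ l (funext fun i => congrFun h (Sum.inl i))
  · exact fun h => h₂ l (funext fun i => congrFun h (Sum.inr i))

/-- The condition number for structured perturbations measured in the maximum norm. -/
theorem isCondNumber_tlsMap_structured_normInf {k : ℕ} {A : Matrix (Fin m) (Fin n) ℝ}
    {b : Fin m → ℝ} (L : Matrix (Fin n) (Fin k) ℝ) (hσ : sigmaTilde A b < sigmaMin A)
    (hS₁ : ∀ C, C ∈ S₁ ↔ ∃ s, Matrix.vec C = Φ₁ *ᵥ s) (hS₂ : ∀ c, c ∈ S₂ ↔ ∃ s, c = Φ₂ *ᵥ s)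
    (h₁ : ColumnOrthogonal Φ₁) (h₂ : ColumnOrthogonal Φ₂) (hr₁ : RowsAtMostOne Φ₁)
    (hr₂ : RowsAtMostOne Φ₂) {s₁ : Fin k₁ → ℝ} {s₂ : Fin k₂ → ℝ} (hA : Matrix.vec A = Φ₁ *ᵥ s₁)
    (hb : b = Φ₂ *ᵥ s₂) (ξ : Fin k → ℝ) :
    IsCondNumber (tlsMap L) (tlsDomain m n) (structuredSet S₁ S₂)
      (normInf (DataIdx m n)) (normInf (Fin k)) (dataVec A b) ξ (dataVec A b)
      ‖entryDiv (absMat (Matrix.fromCols (tlsN A b L * Φ₁) (tlsD A b L * Φ₂)) *ᵥ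
        absVec (Sum.elim s₁ s₂)) (absVec ξ)‖ := by
  refine isCondNumber_tlsMap L hσ (isVecNorm_normInf _) smul_mem_structuredSet ?_
  -- The two structures merge into one block-diagonal structure matrix on the flattened data space.
  have hz : dataVec A b = Matrix.fromBlocks Φ₁ 0 0 Φ₂ *ᵥ Sum.elim s₁ s₂ := by
    rw [fromBlocks_diag_mulVec_sumElim, ← hA, ← hb]
    rfl
  have hT : Matrix.fromCols (tlsN A b L * Φ₁) (tlsD A b L * Φ₂)
      = tlsMatrix A b L * Matrix.fromBlocks Φ₁ 0 0 Φ₂ := by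
    simp [tlsMatrix, Matrix.fromCols_mul_fromBlocks]
  rw [hT, hz]
  refine isLeast_normInf_structured _ (rowsAtMostOne_fromBlocks_diag hr₁ hr₂)
    (col_fromBlocks_diag_ne_zero h₁.1 h₂.1) (fun Δ => ?_) _ ξ
  rw [mem_structuredSet_iff hS₁ hS₂]
  constructor
  · rintro ⟨s₁, s₂, rfl⟩
    exact ⟨Sum.elim s₁ s₂, (fromBlocks_diag_mulVec_sumElim _ _ _ _).symm⟩
  · rintro ⟨s, rfl⟩
    exact ⟨s ∘ Sum.inl, s ∘ Sum.inr, by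
      rw [← fromBlocks_diag_mulVec_sumElim, Sum.elim_comp_inl_inr]⟩

end

theorem isCondNumber_tlsMap_normInf {m n k : ℕ} {A : Matrix (Fin m) (Fin n) ℝ} {b : Fin m → ℝ}
    (L : Matrix (Fin n) (Fin k) ℝ) (hσ : sigmaTilde A b < sigmaMin A) (ξ : Fin k → ℝ) :
    IsCondNumber (tlsMap L) (tlsDomain m n) Set.univ (normInf (DataIdx m n)) (normInf (Fin k))
      (dataVec A b) ξ (dataVec A b)
      ‖entryDiv (absMat (tlsMatrix A b L) *ᵥ absVec (dataVec A b)) (absVec ξ)‖ :=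
  isCondNumber_tlsMap L hσ (isVecNorm_normInf _) (fun _ _ _ => Set.mem_univ _)
    (isLeast_normInf_admissible_univ _ _ _)

theorem isCondNumber_tlsMap_unified {m n k : ℕ} {A : Matrix (Fin m) (Fin n) ℝ} {b : Fin m → ℝ}
    (L : Matrix (Fin n) (Fin k) ℝ) (hσ : sigmaTilde A b < sigmaMin A)
    {μ : Seminorm ℝ (DataIdx m n → ℝ)} (hμ : IsVecNorm μ) (ν : Seminorm ℝ (Fin k → ℝ))
    {β : DataIdx m n → ℝ} (ξ : Fin k → ℝ)
    (hβ : ∀ y, μ (fun i => if β i = 0 then 0 else y i) ≤ μ y) :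
    IsCondNumber (tlsMap L) (tlsDomain m n) Set.univ μ ν β ξ (dataVec A b)
      (inducedNorm μ ν (diagDdag ξ * tlsMatrix A b L * Matrix.diagonal β)) :=
  isCondNumber_tlsMap L hσ hμ (fun _ _ _ => Set.mem_univ _) (isLeast_admissible_univ hμ ν _ ξ hβ)

theorem isCondNumber_tlsMap_norm2 {m n k : ℕ} {A : Matrix (Fin m) (Fin n) ℝ} {b : Fin m → ℝ}
    (L : Matrix (Fin n) (Fin k) ℝ) (hσ : sigmaTilde A b < sigmaMin A) {ψ β ξ : ℝ}
    (hψ : 0 < ψ) (hβ : 0 < β) (hξ : 0 < ξ) :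
    IsCondNumber (tlsMap L) (tlsDomain m n) Set.univ (norm2 (DataIdx m n)) (norm2 (Fin k))
      (dataVec (Matrix.of fun _ _ => ψ) (fun _ => β)) (fun _ => ξ) (dataVec A b)
      (spectralNorm2 (Matrix.fromCols (ψ • tlsN A b L) (β • tlsD A b L)) / ξ) := by
  have hne : ∀ i, dataVec (Matrix.of fun (_ : Fin m) (_ : Fin n) => ψ) (fun _ => β) i ≠ 0 := by
    rintro (i | i)
    · exact hψ.ne'
    · exact hβ.ne'
  have h := isCondNumber_tlsMap_unified L hσ (isVecNorm_norm2 (DataIdx m n)) (norm2 (Fin k))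
    (β := dataVec (Matrix.of fun _ _ => ψ) (fun _ => β)) (fun _ => ξ)
    (fun y => by simp [hne])
  convert h using 1
  -- Both expressions are least elements of the same set of bounds.
  refine (isLeast_inducedNorm_div (isVecNorm_norm2 (DataIdx m n)) (norm2 (Fin k)) _ hξ).unique ?_
  refine (isLeast_inducedNorm (isVecNorm_norm2 (DataIdx m n)) (norm2 (Fin k)) _).of_mem_iff
    fun c => and_congr_right fun _ => forall_congr' fun y => ?_
  rw [diagDdag_mul_mul_diagonal_mulVec]
  rw [← Sum.elim_comp_inl_inr y, Matrix.fromCols_mulVec_sumElim, Matrix.smul_mulVec,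
    Matrix.smul_mulVec]
  have hy : dataVec (Matrix.of fun (_ : Fin m) (_ : Fin n) => ψ) (fun _ => β)
      * Sum.elim (y ∘ Sum.inl) (y ∘ Sum.inr)
      = Sum.elim (ψ • (y ∘ Sum.inl)) (β • (y ∘ Sum.inr)) := by
    ext (i | i) <;> rfl
  rw [hy, tlsMatrix, Matrix.fromCols_mulVec_sumElim, Matrix.mulVec_smul, Matrix.mulVec_smul]

theorem mainTheorem6 {m n k : ℕ} (A : Matrix (Fin m) (Fin n) ℝ) (b : Fin m → ℝ)
    (L : Matrix (Fin n) (Fin k) ℝ) (hσ : sigmaTilde A b < sigmaMin A) :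
    -- the TLS problem as a special ILS problem
    (tlsM A b = Aᵀ * A - sigmaTilde A b ^ 2 • (1 : Matrix (Fin n) (Fin n) ℝ) ∧
      (tlsM A b).PosDef ∧
      tlsX A b = (tlsM A b)⁻¹ *ᵥ (Aᵀ *ᵥ b) ∧
      (∀ y, IsILSSolution (stackJ m n) (stackA A b) (stackB n b) y ↔ y = tlsX A b) ∧
      (∀ y, IsTLSSolution A b y ↔ y = tlsX A b)) ∧
    IsOpen (tlsDomain m n) ∧
    -- the partial unified condition number
    (∀ (μ : Seminorm ℝ (DataIdx m n → ℝ)) (ν : Seminorm ℝ (Fin k → ℝ)),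
      IsVecNorm μ → IsVecNorm ν →
      ∀ (Ψ : Matrix (Fin m) (Fin n) ℝ) (β : Fin m → ℝ) (ξ : Fin k → ℝ),
        (∀ y, μ (fun i => if dataVec Ψ β i = 0 then 0 else y i) ≤ μ y) →
        IsCondNumber (tlsMap L) (tlsDomain m n) Set.univ μ ν (dataVec Ψ β) ξ (dataVec A b)
          (inducedNorm μ ν
            (diagDdag ξ * tlsMatrix A b L * Matrix.diagonal (dataVec Ψ β)))) ∧
    -- the 2-norm, with positive real parameters
    (∀ ψ β ξ : ℝ, 0 < ψ → 0 < β → 0 < ξ →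
      IsCondNumber (tlsMap L) (tlsDomain m n) Set.univ (norm2 (DataIdx m n)) (norm2 (Fin k))
        (dataVec (Matrix.of fun _ _ => ψ) (fun _ => β)) (fun _ => ξ) (dataVec A b)
        (spectralNorm2 (Matrix.fromCols (ψ • tlsN A b L) (β • tlsD A b L)) / ξ)) ∧
    -- the mixed condition number
    IsCondNumber (tlsMap L) (tlsDomain m n) Set.univ (normInf (DataIdx m n)) (normInf (Fin k))
      (dataVec A b) (fun _ => ‖Lᵀ *ᵥ tlsX A b‖) (dataVec A b)
      (ddag ‖Lᵀ *ᵥ tlsX A b‖ * ‖absMat (tlsMatrix A b L) *ᵥ absVec (dataVec A b)‖) ∧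
    -- the componentwise condition number
    IsCondNumber (tlsMap L) (tlsDomain m n) Set.univ (normInf (DataIdx m n)) (normInf (Fin k))
      (dataVec A b) (Lᵀ *ᵥ tlsX A b) (dataVec A b)
      ‖entryDiv (absMat (tlsMatrix A b L) *ᵥ absVec (dataVec A b))
        (absVec (Lᵀ *ᵥ tlsX A b))‖ ∧
    -- the structured condition numbers
    (∀ (S₁ : Submodule ℝ (Matrix (Fin m) (Fin n) ℝ)) (S₂ : Submodule ℝ (Fin m → ℝ)) (k₁ k₂ : ℕ)
      (Φ₁ : Matrix (Fin n × Fin m) (Fin k₁) ℝ) (Φ₂ : Matrix (Fin m) (Fin k₂) ℝ),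
      (∀ C, C ∈ S₁ ↔ ∃ s, Matrix.vec C = Φ₁ *ᵥ s) → (∀ c, c ∈ S₂ ↔ ∃ s, c = Φ₂ *ᵥ s) →
      ColumnOrthogonal Φ₁ → ColumnOrthogonal Φ₂ →
      -- 2-norm, with positive real parameters
      (∀ ψ β ξ : ℝ, 0 < ψ → 0 < β → 0 < ξ →
        IsCondNumber (tlsMap L) (tlsDomain m n) (structuredSet S₁ S₂)
          (norm2 (DataIdx m n)) (norm2 (Fin k))
          (dataVec (Matrix.of fun _ _ => ψ) (fun _ => β)) (fun _ => ξ) (dataVec A b)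
          (spectralNorm2 (Matrix.fromCols
            (ψ • (tlsN A b L * Φ₁ * (colNormDiag Φ₁)⁻¹))
            (β • (tlsD A b L * Φ₂ * (colNormDiag Φ₂)⁻¹))) / ξ)) ∧
      -- mixed and componentwise
      (RowsAtMostOne Φ₁ → RowsAtMostOne Φ₂ →
        ∀ (s₁ : Fin k₁ → ℝ) (s₂ : Fin k₂ → ℝ), Matrix.vec A = Φ₁ *ᵥ s₁ → b = Φ₂ *ᵥ s₂ →
          IsCondNumber (tlsMap L) (tlsDomain m n) (structuredSet S₁ S₂)
            (normInf (DataIdx m n)) (normInf (Fin k))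
            (dataVec A b) (fun _ => ‖Lᵀ *ᵥ tlsX A b‖) (dataVec A b)
            (ddag ‖Lᵀ *ᵥ tlsX A b‖ *
              ‖absMat (Matrix.fromCols (tlsN A b L * Φ₁) (tlsD A b L * Φ₂)) *ᵥ
                absVec (Sum.elim s₁ s₂)‖) ∧
          IsCondNumber (tlsMap L) (tlsDomain m n) (structuredSet S₁ S₂)
            (normInf (DataIdx m n)) (normInf (Fin k))
            (dataVec A b) (Lᵀ *ᵥ tlsX A b) (dataVec A b)
            ‖entryDiv
              (absMat (Matrix.fromCols (tlsN A b L * Φ₁) (tlsD A b L * Φ₂)) *ᵥ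
                absVec (Sum.elim s₁ s₂))
              (absVec (Lᵀ *ᵥ tlsX A b))‖)) := by
  refine ⟨⟨tlsM_eq A b, posDef_tlsM hσ, tlsX_eq A b, isILSSolution_iff hσ, isTLSSolution_iff hσ⟩,
    isOpen_tlsDomain m n,
    fun μ ν hμ _ Ψ β ξ hβ => isCondNumber_tlsMap_unified L hσ hμ ν ξ hβ,
    fun ψ β ξ hψ hβ hξ => isCondNumber_tlsMap_norm2 L hσ hψ hβ hξ, ?_,
    isCondNumber_tlsMap_normInf L hσ _,
    fun S₁ S₂ k₁ k₂ Φ₁ Φ₂ hS₁ hS₂ h₁ h₂ => ⟨fun ψ β ξ hψ hβ hξ => ?_,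
      fun hr₁ hr₂ s₁ s₂ hA hb => ⟨?_, isCondNumber_tlsMap_structured_normInf L hσ hS₁ hS₂ h₁ h₂
        hr₁ hr₂ hA hb _⟩⟩⟩
  -- The mixed case is the general one with constant `ξ`, whose `ddag` factors out of the norm.
  · rw [← norm_entryDiv_absVec_const _ (norm_nonneg _)]
    exact isCondNumber_tlsMap_normInf L hσ _
  · exact isCondNumber_tlsMap L hσ (isVecNorm_norm2 _) smul_mem_structuredSet
      (isLeast_norm2_structured _ _ h₁ h₂ (mem_structuredSet_iff hS₁ hS₂) hψ hβ hξ)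
  · rw [← norm_entryDiv_absVec_const _ (norm_nonneg _)]
    exact isCondNumber_tlsMap_structured_normInf L hσ hS₁ hS₂ h₁ h₂ hr₁ hr₂ hA hb _
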